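/- Let $\mathbb{K}$ be a field of characteristic zero. A unitary Com-PreLie algebra over $\mathbb{K}$ is a vector space $A$ with two bilinear products $\cdot$ and $\bullet$ such that $(A,\cdot)$ is a commutative, associative, unitary algebra and, for all $a,b,c\in A$, $$(a\bullet b)\bullet c-a\bullet(b\bullet c)=(a\bullet c)\bullet b-a\bullet(c\bullet b),\qquad (a\cdot b)\bullet c=(a\bullet c)\cdot b+a\cdot(b\bullet c).$$ Morphisms of unitary Com-PreLie algebras are the linear maps compatible with $\cdot$, $\bullet$ and the units. Let $\mathcal{D}$ be a set. A partitioned tree decorated by $\mathbb{N}\times\mathcal{D}$ is a finite rooted forest, possibly empty, with a map from its set of vertices $V(T)$ to $\mathbb{N}\times\mathcal{D}$ and a partition of $V(T)$ into blocks, such that two vertices in the same block are either both roots or have the same direct ascendant, and such that all roots are in the same block. Let $\mathcal{UPT}(\mathcal{D})$ be the set of isomorphism classes of partitioned trees decorated by $\mathbb{N}\times\mathcal{D}$, let $\emptyset$ be the empty tree, and let $UCP(\mathcal{D})$ be the $\mathbb{K}$-vector space with basis $\mathcal{UPT}(\mathcal{D})$. For $T,T'\in\mathcal{UPT}(\mathcal{D})$,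 let $T\cdot T'$ be the disjoint union of $T$ and $T'$ in which the block of roots of $T$ and the block of roots of $T'$ are joined into one block, the other blocks being unchanged. For $s\in V(T)$, let $T\bullet_{s,*}T'$ be obtained from the disjoint union of $T$ and $T'$ by adding an edge from $s$ to every root of $T'$, the blocks being those of $T$ and those of $T'$; and let $T[+1]_s$ be obtained from $T$ by replacing the decoration $(i,d)$ of $s$ by $(i+1,d)$. Extend $\cdot$ bilinearly to $UCP(\mathcal{D})$ and let $\bullet$ be the bilinear product on $UCP(\mathcal{D})$ such that, for all $T,T'\in\mathcal{UPT}(\mathcal{D})$, $$T\bullet T'=\begin{cases}\displaystyle\sum_{s\in V(T)}T\bullet_{s,*}T' & \text{if } T'\neq\emptyset,\\ \displaystyle\sum_{s\in V(T)}T[+1]_s & \text{if } T'=\emptyset.\end{cases}$$ Then $(UCP(\mathcal{D}),\cdot,\bullet)$ is a unitary Com-PreLie algebra, of unit $\emptyset$, and it is the free unitary Com-PreLie algebra generated by the one-vertex trees decorated by $(0,d)$, $d\in\mathcal{D}$: for every unitary Com-PreLie algebra $A$ and every family $(a_d)_{d\in\mathcal{D}}$ of elements of $A$, there is a unique morphism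 of unitary Com-PreLie algebras $\phi:UCP(\mathcal{D})\to A$ sending, for every $d\in\mathcal{D}$, the one-vertex tree decorated by $(0,d)$ to $a_d$. -/

import Mathlib

universe u v w

/-! ### Unitary Com-PreLie algebras -/

/-- A unitary Com-PreLie algebra: a `K`-vector space `A` with two bilinear products,
`mul` (written `a · b`) and `pre` (written `a • b`), and a unit `one` for `mul`. -/
structure IsUnitaryComPreLie {K : Type v} [Field K] {A : Type w} [AddCommGroup A] [Module K A]
    (mul pre : A →ₗ[K] A →ₗ[K] A) (one : A) : Prop where
  mul_comm : ∀ a b, mul a b = mul b a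
  mul_assoc : ∀ a b c, mul (mul a b) c = mul a (mul b c)
  one_mul : ∀ a, mul one a = a
  /-- The (right) preLie identity. -/
  preLie : ∀ a b c, pre (pre a b) c - pre a (pre b c) = pre (pre a c) b - pre a (pre c b)
  /-- The Leibniz identity. -/
  leibniz : ∀ a b c, pre (mul a b) c = mul (pre a c) b + mul a (pre b c)

/-- Morphisms of unitary Com-PreLie algebras. -/
structure IsUnitaryComPreLieHom {K : Type v} [Field K]
    {A : Type u} [AddCommGroup A] [Module K A] {B : Type w} [AddCommGroup B] [Module K B]
    (mulA preA : A →ₗ[K] A →ₗ[K] A) (oneA : A) (mulB preB : B →ₗ[K] B →ₗ[K] B) (oneB : B)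
    (φ : A →ₗ[K] B) : Prop where
  map_mul : ∀ x y, φ (mulA x y) = mulB (φ x) (φ y)
  map_pre : ∀ x y, φ (preA x y) = preB (φ x) (φ y)
  map_one : φ oneA = oneB

/-! ### Partitioned forests and trees -/

/-- A finite partitioned forest decorated by `D`. The rooted forest is given by its finite vertex
set and the map sending a vertex to its direct ascendant (`none` for the roots), without infinite
ascending path. The partition of the vertices is an equivalence relation; two vertices in the same
block are both roots or have the same direct ascendant. -/
structure PartitionedForest (D : Type u) where
  V : Type
  [fintypeV : Fintype V]
  parent : V → Option V
  wf : WellFounded fun x y => parent y = some x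
  block : Setoid V
  parent_eq_of_block : ∀ x y, block.r x y → parent x = parent y
  dec : V → D

attribute [instance] PartitionedForest.fintypeV

/-- A partitioned tree: a partitioned forest whose roots all lie in one block
(the empty forest is allowed). -/
structure PartitionedTree (D : Type u) extends PartitionedForest D where
  block_of_roots : ∀ x y, parent x = none → parent y = none → block.r x y

namespace PartitionedTree

/-- Isomorphisms of decorated partitioned trees. -/
structure Iso {D : Type u} (T T' : PartitionedTree D) where
  toEquiv : T.V ≃ T'.V
  parent_eq : ∀ x, T'.parent (toEquiv x) = (T.parent x).map toEquiv
  block_iff : ∀ x y, T'.block.r (toEquiv x) (toEquiv y) ↔ T.block.r x y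
  dec_eq : ∀ x, T'.dec (toEquiv x) = T.dec x

/-- Two decorated partitioned trees are equivalent when they are isomorphic. -/
instance isoSetoid (D : Type u) : Setoid (PartitionedTree D) where
  r T T' := Nonempty (Iso T T')
  iseqv :=
    { refl := fun T => ⟨⟨Equiv.refl _, fun x => by simp, fun _ _ => Iff.rfl, fun _ => rfl⟩⟩
      symm := by
        rintro T T' ⟨e, hp, hb, hd⟩
        refine ⟨⟨e.symm, fun x => ?_, fun x y => ?_, fun x => ?_⟩⟩
        · have := hp (e.symm x)
          rw [e.apply_symm_apply] at this
          simp [this]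
        · simpa using (hb (e.symm x) (e.symm y)).symm
        · simpa using (hd (e.symm x)).symm
      trans := by
        rintro T T' T'' ⟨e, hp, hb, hd⟩ ⟨e', hp', hb', hd'⟩
        refine ⟨⟨e.trans e', fun x => ?_, fun x y => ?_, fun x => ?_⟩⟩
        · simp [hp', hp]
        · simp [hb', hb]
        · simp [hd', hd] }

/-- The empty partitioned tree `∅`. -/
def empty (D : Type u) : PartitionedTree D where
  V := Empty
  parent := fun x => x.elim
  wf := ⟨fun x => x.elim⟩
  block := ⊤
  parent_eq_of_block := fun x => x.elim
  dec := fun x => x.elim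
  block_of_roots := fun x => x.elim

/-- The partitioned tree with one vertex, decorated by `d`. -/
def vertex {D : Type u} (d : D) : PartitionedTree D where
  V := Unit
  parent := fun _ => none
  wf := ⟨fun _ => ⟨_, fun _ h => by simp at h⟩⟩
  block := ⊤
  parent_eq_of_block := fun _ _ _ => rfl
  dec := fun _ => d
  block_of_roots := fun _ _ _ _ => trivial

/-- The ascendant map of the disjoint union of two forests. -/
def mulParent {D : Type u} (T T' : PartitionedTree D) : T.V ⊕ T'.V → Option (T.V ⊕ T'.V)
  | .inl x => (T.parent x).map .inl
  | .inr y => (T'.parent y).map .inr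

/-- The blocks of `T · T'`: those of `T` and `T'`, the two blocks of roots being joined. -/
def mulBlock {D : Type u} (T T' : PartitionedTree D) : T.V ⊕ T'.V → T.V ⊕ T'.V → Prop
  | .inl x, .inl y => T.block.r x y
  | .inr x, .inr y => T'.block.r x y
  | .inl x, .inr y => T.parent x = none ∧ T'.parent y = none
  | .inr x, .inl y => T'.parent x = none ∧ T.parent y = none

/-- The product `T · T'`: the disjoint union of the forests, all roots being put in one block. -/
def mul {D : Type u} (T T' : PartitionedTree D) : PartitionedTree D where
  V := T.V ⊕ T'.V
  parent := mulParent T T'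
  wf := by
    constructor
    rintro (x | x)
    · induction x using T.wf.induction with
      | _ x ih =>
        refine ⟨_, ?_⟩
        rintro (y | y) h
        · exact ih y (by simpa [mulParent] using h)
        · simp [mulParent] at h
    · induction x using T'.wf.induction with
      | _ x ih =>
        refine ⟨_, ?_⟩
        rintro (y | y) h
        · simp [mulParent] at h
        · exact ih y (by simpa [mulParent] using h)
  block :=
    { r := mulBlock T T'
      iseqv :=
        { refl := by
            rintro (x | x)
            · exact T.block.iseqv.refl x
            · exact T'.block.iseqv.refl x
          symm := by
            rintro (x | x) (y | y) h
            · exact T.block.iseqv.symm h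
            · exact h.symm
            · exact h.symm
            · exact T'.block.iseqv.symm h
          trans := by
            rintro (x | x) (y | y) (z | z) h h'
            · exact T.block.iseqv.trans h h'
            · exact ⟨(T.parent_eq_of_block _ _ h).trans h'.1, h'.2⟩
            · exact T.block_of_roots _ _ h.1 h'.2
            · exact ⟨h.1, (T'.parent_eq_of_block _ _ h').symm.trans h.2⟩
            · exact ⟨h.1, (T.parent_eq_of_block _ _ h').symm.trans h.2⟩
            · exact T'.block_of_roots _ _ h.1 h'.2
            · exact ⟨(T'.parent_eq_of_block _ _ h).trans h'.1, h'.2⟩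
            · exact T'.block.iseqv.trans h h' } }
  parent_eq_of_block := by
    rintro (x | x) (y | y) h
    · simp [mulParent, T.parent_eq_of_block x y h]
    · simp [mulParent, h.1, h.2]
    · simp [mulParent, h.1, h.2]
    · simp [mulParent, T'.parent_eq_of_block x y h]
  dec := Sum.elim T.dec T'.dec
  block_of_roots := by
    rintro (x | x) (y | y) h h'
    · exact T.block_of_roots x y (by simpa [mulParent] using h) (by simpa [mulParent] using h')
    · exact ⟨by simpa [mulParent] using h, by simpa [mulParent] using h'⟩
    · exact ⟨by simpa [mulParent] using h, by simpa [mulParent] using h'⟩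
    · exact T'.block_of_roots x y (by simpa [mulParent] using h) (by simpa [mulParent] using h')

/-- The ascendant map of the grafting of `T'` on the vertex `s` of `T`: the direct ascendant of
every root of `T'` becomes `s`. -/
def graftParent {D : Type u} (T : PartitionedTree D) (s : T.V) (T' : PartitionedTree D) :
    T.V ⊕ T'.V → Option (T.V ⊕ T'.V)
  | .inl x => (T.parent x).map .inl
  | .inr y => some ((T'.parent y).elim (.inl s) .inr)

/-- The blocks of the grafting: those of `T` and those of `T'`. -/
def graftBlock {D : Type u} (T T' : PartitionedTree D) : T.V ⊕ T'.V → T.V ⊕ T'.V → Prop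
  | .inl x, .inl y => T.block.r x y
  | .inr x, .inr y => T'.block.r x y
  | .inl _, .inr _ => False
  | .inr _, .inl _ => False

/-- The grafting `T •_{s,*} T'`: an edge is added from the vertex `s` of `T` to every root of `T'`,
and the roots of `T'` form a block of their own. -/
def graft {D : Type u} (T : PartitionedTree D) (s : T.V) (T' : PartitionedTree D) :
    PartitionedTree D where
  V := T.V ⊕ T'.V
  parent := graftParent T s T'
  wf := by
    have hl : ∀ x : T.V, Acc (fun a b => graftParent T s T' b = some a) (.inl x) := by
      intro x
      induction x using T.wf.induction with
      | _ x ih =>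
        refine ⟨_, ?_⟩
        rintro (y | y) h
        · exact ih y (by simpa [graftParent] using h)
        · simp [graftParent] at h
    constructor
    rintro (x | x)
    · exact hl x
    · induction x using T'.wf.induction with
      | _ x ih =>
        refine ⟨_, ?_⟩
        rintro (y | y) h
        · exact hl y
        · refine ih y ?_
          cases hx : T'.parent x <;> simp_all [graftParent]
  block :=
    { r := graftBlock T T'
      iseqv :=
        { refl := by
            rintro (x | x)
            · exact T.block.iseqv.refl x
            · exact T'.block.iseqv.refl x
          symm := by
            rintro (x | x) (y | y) h
            · exact T.block.iseqv.symm h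
            · exact h.elim
            · exact h.elim
            · exact T'.block.iseqv.symm h
          trans := by
            rintro (x | x) (y | y) (z | z) h h'
            · exact T.block.iseqv.trans h h'
            · exact h'.elim
            · exact h.elim
            · exact h.elim
            · exact h.elim
            · exact h.elim
            · exact h'.elim
            · exact T'.block.iseqv.trans h h' } }
  parent_eq_of_block := by
    rintro (x | x) (y | y) h
    · simp [graftParent, T.parent_eq_of_block x y h]
    · exact h.elim
    · exact h.elim
    · simp [graftParent, T'.parent_eq_of_block x y h]
  dec := Sum.elim T.dec T'.dec
  block_of_roots := by
    rintro (x | x) (y | y) h h'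
    · exact T.block_of_roots x y (by simpa [graftParent] using h)
        (by simpa [graftParent] using h')
    · simp [graftParent] at h'
    · simp [graftParent] at h
    · simp [graftParent] at h

open Classical in
/-- `T[+1]_s`: the decoration `(i, d)` of the vertex `s` is replaced by `(i + 1, d)`. -/
noncomputable def raise {D : Type u} (T : PartitionedTree (ℕ × D)) (s : T.V) :
    PartitionedTree (ℕ × D) where
  V := T.V
  parent := T.parent
  wf := T.wf
  block := T.block
  parent_eq_of_block := T.parent_eq_of_block
  dec := fun x => if x = s then ((T.dec x).1 + 1, (T.dec x).2) else T.dec x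
  block_of_roots := T.block_of_roots

theorem mul_congr {D : Type u} {T₁ T₂ T₁' T₂' : PartitionedTree D} (h : T₁ ≈ T₂)
    (h' : T₁' ≈ T₂') : mul T₁ T₁' ≈ mul T₂ T₂' := by
  obtain ⟨e, hp, hb, hd⟩ := h
  obtain ⟨e', hp', hb', hd'⟩ := h'
  refine ⟨⟨Equiv.sumCongr e e', ?_, ?_, ?_⟩⟩
  · rintro (x | x)
    · change (T₂.parent (e x)).map Sum.inl = ((T₁.parent x).map Sum.inl).map _
      rw [hp]
      cases T₁.parent x <;> rfl
    · change (T₂'.parent (e' x)).map Sum.inr = ((T₁'.parent x).map Sum.inr).map _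
      rw [hp']
      cases T₁'.parent x <;> rfl
  · rintro (x | x) (y | y)
    · exact hb x y
    · change (T₂.parent (e x) = none ∧ T₂'.parent (e' y) = none) ↔
        (T₁.parent x = none ∧ T₁'.parent y = none)
      simp [hp, hp']
    · change (T₂'.parent (e' x) = none ∧ T₂.parent (e y) = none) ↔
        (T₁'.parent x = none ∧ T₁.parent y = none)
      simp [hp, hp']
    · exact hb' x y
  · rintro (x | x)
    · exact hd x
    · exact hd' x

theorem graft_congr {D : Type u} {T₁ T₂ T₁' T₂' : PartitionedTree D} (i : Iso T₁ T₂)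
    (h' : T₁' ≈ T₂') (s : T₁.V) : graft T₁ s T₁' ≈ graft T₂ (i.toEquiv s) T₂' := by
  obtain ⟨e, hp, hb, hd⟩ := i
  obtain ⟨e', hp', hb', hd'⟩ := h'
  refine ⟨⟨Equiv.sumCongr e e', ?_, ?_, ?_⟩⟩
  · rintro (x | x)
    · change (T₂.parent (e x)).map Sum.inl = ((T₁.parent x).map Sum.inl).map _
      rw [hp]
      cases T₁.parent x <;> rfl
    · change some ((T₂'.parent (e' x)).elim (Sum.inl (e s)) Sum.inr) =
        (some ((T₁'.parent x).elim (Sum.inl s) Sum.inr)).map _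
      rw [hp']
      cases T₁'.parent x <;> rfl
  · rintro (x | x) (y | y)
    · exact hb x y
    · exact Iff.rfl
    · exact Iff.rfl
    · exact hb' x y
  · rintro (x | x)
    · exact hd x
    · exact hd' x

open Classical in
theorem raise_congr {D : Type u} {T₁ T₂ : PartitionedTree (ℕ × D)} (i : Iso T₁ T₂)
    (s : T₁.V) : raise T₁ s ≈ raise T₂ (i.toEquiv s) := by
  obtain ⟨e, hp, hb, hd⟩ := i
  refine ⟨⟨e, hp, hb, fun (x : T₁.V) => ?_⟩⟩
  change (if e x = e s then ((T₂.dec (e x)).1 + 1, (T₂.dec (e x)).2) else T₂.dec (e x)) =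
    if x = s then ((T₁.dec x).1 + 1, (T₁.dec x).2) else T₁.dec x
  rw [hd]
  simp only [e.injective.eq_iff]

end PartitionedTree

/-- `PT(D)`: isomorphism classes of partitioned trees decorated by `D`. -/
def PT (D : Type u) : Type (max 1 u) := Quotient (PartitionedTree.isoSetoid D)

/-- `UPT(D)`: isomorphism classes of partitioned trees decorated by `ℕ × D`. -/
abbrev UPT (D : Type u) : Type (max 1 u) := PT (ℕ × D)

/-- The class of a partitioned tree. -/
def PT.mk {D : Type u} (T : PartitionedTree D) : PT D := Quotient.mk _ T

/-- The product `T · T'` of classes of partitioned trees. -/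
def PT.mul {D : Type u} : PT D → PT D → PT D :=
  Quotient.lift₂ (fun T T' => PT.mk (T.mul T'))
    (fun _ _ _ _ h h' => Quotient.sound (PartitionedTree.mul_congr h h'))

/-! ### The vector space `UCP(D)` and its two products -/

/-- `UCP(D)`: the `K`-vector space with basis `UPT(D)`. -/
abbrev UCP (K : Type v) [Field K] (D : Type u) : Type (max 1 u v) := UPT D →₀ K

namespace UCP

/-- The class of `T`, as an element of the basis `UPT(D)` of `UCP(D)`. -/
noncomputable def tree (K : Type v) [Field K] {D : Type u} (T : PartitionedTree (ℕ × D)) :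
    UCP K D := Finsupp.single (PT.mk T) 1

open Classical in
/-- `T • T'` for two partitioned trees: the sum of the graftings `T •_{s,*} T'` over the vertices
`s` of `T` if `T'` is not empty, and the sum of the `T[+1]_s` if `T' = ∅`. -/
noncomputable def preTree (K : Type v) [Field K] {D : Type u} (T T' : PartitionedTree (ℕ × D)) :
    UCP K D :=
  if IsEmpty T'.V then ∑ s : T.V, tree K (T.raise s) else ∑ s : T.V, tree K (T.graft s T')

theorem preTree_congr (K : Type v) [Field K] {D : Type u}
    {T₁ T₁' T₂ T₂' : PartitionedTree (ℕ × D)} (h : T₁ ≈ T₂) (h' : T₁' ≈ T₂') :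
    preTree K T₁ T₁' = preTree K T₂ T₂' := by
  obtain ⟨i⟩ := h
  have hE : IsEmpty T₁'.V ↔ IsEmpty T₂'.V := by
    obtain ⟨i'⟩ := h'
    exact i'.toEquiv.isEmpty_congr
  unfold preTree
  by_cases hT : IsEmpty T₁'.V
  · rw [if_pos hT, if_pos (hE.1 hT)]
    refine Fintype.sum_equiv i.toEquiv _ _ fun s => ?_
    exact congrArg (fun t => Finsupp.single t (1 : K))
      (Quotient.sound (PartitionedTree.raise_congr i s))
  · rw [if_neg hT, if_neg (fun h => hT (hE.2 h))]
    refine Fintype.sum_equiv i.toEquiv _ _ fun s => ?_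
    exact congrArg (fun t => Finsupp.single t (1 : K))
      (Quotient.sound (PartitionedTree.graft_congr i h' s))

/-- `T • T'` for two elements of the basis `UPT(D)`. -/
noncomputable def preBasis (K : Type v) [Field K] {D : Type u} : UPT D → UPT D → UCP K D :=
  Quotient.lift₂ (preTree K) (fun _ _ _ _ h h' => preTree_congr K h h')

/-- The bilinear extension of the product `T · T'`. -/
noncomputable def mul (K : Type v) [Field K] (D : Type u) :
    UCP K D →ₗ[K] UCP K D →ₗ[K] UCP K D :=
  Finsupp.linearCombination K fun T =>
    Finsupp.linearCombination K fun T' => Finsupp.single (PT.mul T T') (1 : K)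

/-- The preLie product of `UCP(D)`: the bilinear extension of `T • T'`. -/
noncomputable def pre (K : Type v) [Field K] (D : Type u) :
    UCP K D →ₗ[K] UCP K D →ₗ[K] UCP K D :=
  Finsupp.linearCombination K fun T => Finsupp.linearCombination K fun T' => preBasis K T T'

/-- The unit of `UCP(D)`: the empty tree. -/
noncomputable def one (K : Type v) [Field K] (D : Type u) : UCP K D :=
  tree K (PartitionedTree.empty (ℕ × D))

end UCP

/-! That the two products satisfy the axioms is read off trees. Modifying a vertex of `T · T'`
modifies one of the factors, which is the Leibniz identity. In the associator of `T`, `S`, `S'` the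
graftings of `S'` on vertices of `S` cancel; what remains is a sum over pairs of vertices of `T`,
symmetric in `S` and `S'`. Raising a decoration behaves like grafting an empty tree (`tree_preLie`).

Existence of the morphism. The preLie product of `A` yields symmetric braces `a{x₁, ..., xₙ}` (Oudom
and Guin), defined by `a{x, M} = a{M} • x - ∑ m ∈ M, a{m • x, M - m}`; their symmetry is equivalent
in spirit to the preLie identity (`permInvariant_braceList`). A vertex decorated by `(i, d)` takes
as value the brace of `a_d` with `i` copies of `1` and with one entry for each block of its direct
descendants, namely the product of their values. A tree is sent to the product of the values of its
roots. Read backwards, the recursion says that acting by `c` on a brace either adds `c` as an entry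
or acts on an entry; with the Leibniz rule, acting by `c` on the value of a tree is summing over all
vertices `s` the result of adding the entry `c` at `s` (`sum_val_update`). The copies of `1` do not
contribute, since `1 • c = 0`. If `c` is the value of a nonempty tree, the new entry is that of a
new block, hence a grafting; if `c = 1`, it is a raising (`eval_graft`, `eval_raise`).

Uniqueness. A nonempty tree is a generator, a product of smaller trees, or comes from a one-root
tree `T'` by a raising or grafting at its root `r` (`decomposition`). In the last case it is one
term of `T' • S`; the other terms have the same weight but smaller fertility at the root. Induction
on weight, then on root fertility, determines the image of every tree (`induction_on`,
`hom_unique`). -/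

/-- A commutative ring with a biadditive preLie product satisfying the Leibniz identity. -/
class ComPreLieRing (A : Type w) extends CommRing A where
  preHom : A →+ A →+ A
  preHom_preHom : ∀ a b c : A, preHom (preHom a b) c - preHom a (preHom b c) =
    preHom (preHom a c) b - preHom a (preHom c b)
  mul_preHom : ∀ a b c : A, preHom (a * b) c = preHom a c * b + a * preHom b c

/-! ### Calculus in a Com-PreLie ring -/

namespace ComPreLieRing

variable {A : Type w}

/-- The preLie product. -/
def pre [ComPreLieRing A] (a b : A) : A := (preHom : A →+ A →+ A) a b

variable [ComPreLieRing A]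

theorem pre_pre (a b c : A) :
    pre (pre a b) c - pre a (pre b c) = pre (pre a c) b - pre a (pre c b) :=
  preHom_preHom a b c

theorem mul_pre (a b c : A) : pre (a * b) c = pre a c * b + a * pre b c := mul_preHom a b c

theorem pre_add (a b c : A) : pre a (b + c) = pre a b + pre a c :=
  map_add ((preHom : A →+ A →+ A) a) b c

theorem add_pre (a b c : A) : pre (a + b) c = pre a c + pre b c := by simp [pre]

theorem zero_pre (c : A) : pre 0 c = 0 := by simp [pre]

theorem sub_pre (a b c : A) : pre (a - b) c = pre a c - pre b c := by simp [pre]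

/-- `· • c` is a derivation, so it kills the unit. This makes the copies of `1` that encode integer
decorations inert. -/
theorem one_pre (c : A) : pre (1 : A) c = 0 := by
  have h := mul_pre (1 : A) 1 c
  simpa using h

theorem prod_pre {ι : Type*} [DecidableEq ι] (s : Finset ι) (f : ι → A) (c : A) :
    pre (∏ i ∈ s, f i) c = ∑ i ∈ s, pre (f i) c * ∏ j ∈ s.erase i, f j := by
  induction s using Finset.induction_on with
  | empty => simp [one_pre]
  | insert i s hi ih =>
    rw [Finset.prod_insert hi, mul_pre, ih, Finset.sum_insert hi, Finset.erase_insert hi,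
      Finset.mul_sum]
    congr 1
    refine Finset.sum_congr rfl fun j hj => ?_
    have hij : i ≠ j := fun h => hi (h ▸ hj)
    rw [Finset.erase_insert_of_ne hij, Finset.prod_insert (fun h => hi (Finset.mem_of_mem_erase h))]
    ring

/-! ### Symmetric braces -/

/-- The sum of the values of `F` at the lists obtained from `l` by replacing one entry `m` by
`m • x`. -/
def listDeriv (x : A) : (List A → A) → List A → A
  | _, [] => 0
  | F, c :: l => F (pre c x :: l) + listDeriv x (fun l => F (c :: l)) l

/-- Additivity in each entry of a list. -/
def MultiAdditive (F : List A → A) : Prop :=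
  ∀ l₁ u v l₂, F (l₁ ++ (u + v) :: l₂) = F (l₁ ++ u :: l₂) + F (l₁ ++ v :: l₂)

/-- Invariance under permutation of the entries of a list. -/
def PermInvariant (F : List A → A) : Prop := ∀ l l', l.Perm l' → F l = F l'

theorem MultiAdditive.head {F : List A → A} (h : MultiAdditive F) (u v : A) (l : List A) :
    F ((u + v) :: l) = F (u :: l) + F (v :: l) := h [] u v l

theorem MultiAdditive.tail {F : List A → A} (h : MultiAdditive F) (c : A) :
    MultiAdditive fun l => F (c :: l) := fun l₁ u v l₂ => h (c :: l₁) u v l₂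

omit [ComPreLieRing A] in
theorem PermInvariant.tail {F : List A → A} (h : PermInvariant F) (c : A) :
    PermInvariant fun l => F (c :: l) := fun _ _ hl => h _ _ (hl.cons c)

theorem listDeriv_zero (x : A) (l : List A) : listDeriv x (fun _ => 0) l = 0 := by
  induction l with
  | nil => rfl
  | cons c l ih => simp [listDeriv, ih]

theorem listDeriv_add (x : A) (F G : List A → A) (l : List A) :
    listDeriv x (fun l => F l + G l) l = listDeriv x F l + listDeriv x G l := by
  induction l generalizing F G with
  | nil => simp [listDeriv]
  | cons c l ih => simp only [listDeriv, ih]; abel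

theorem listDeriv_sub (x : A) (F G : List A → A) (l : List A) :
    listDeriv x (fun l => F l - G l) l = listDeriv x F l - listDeriv x G l := by
  induction l generalizing F G with
  | nil => simp [listDeriv]
  | cons c l ih => simp only [listDeriv, ih]; abel

theorem listDeriv_pre (x y : A) (F : List A → A) (l : List A) :
    listDeriv x (fun l => pre (F l) y) l = pre (listDeriv x F l) y := by
  induction l generalizing F with
  | nil => simp [listDeriv, zero_pre]
  | cons c l ih => simp only [listDeriv, ih, add_pre]

theorem MultiAdditive.listDeriv_add_left {F : List A → A} (h : MultiAdditive F) (x y : A)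
    (l : List A) : listDeriv (x + y) F l = listDeriv x F l + listDeriv y F l := by
  induction l generalizing F with
  | nil => simp [listDeriv]
  | cons c l ih => simp only [listDeriv, ih (h.tail c), pre_add, h.head]; abel

theorem MultiAdditive.listDeriv {F : List A → A} (h : MultiAdditive F) (x : A) :
    MultiAdditive (listDeriv x F) := by
  intro l₁ u v l₂
  induction l₁ generalizing F with
  | nil =>
    simp only [List.nil_append, ComPreLieRing.listDeriv, add_pre, h.head,
      listDeriv_add]
    abel
  | cons c l ih =>
    simp only [List.cons_append, ComPreLieRing.listDeriv, ih (h.tail c)]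
    rw [← List.cons_append, h]
    simp only [List.cons_append]
    abel

theorem PermInvariant.listDeriv {F : List A → A} (h : PermInvariant F) (x : A) :
    PermInvariant (listDeriv x F) := by
  intro l l' hl
  induction hl generalizing F with
  | nil => rfl
  | cons c hl ih =>
    simp only [ComPreLieRing.listDeriv]
    rw [ih (h.tail c), h _ _ (hl.cons _)]
  | swap a b l =>
    simp only [ComPreLieRing.listDeriv]
    rw [h _ _ (List.Perm.swap a (pre b x) l), h _ _ (List.Perm.swap (pre a x) b l)]
    have : (fun l => F (b :: a :: l)) = fun l => F (a :: b :: l) :=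
      funext fun l => h _ _ (List.Perm.swap a b l)
    rw [this]
    abel
  | trans _ _ ih ih' => exact (ih h).trans (ih' h)

/-- The preLie identity propagates from single entries to lists: terms in which `x` and `y` act on
different entries are symmetric, and those in which both act on the same entry are governed by
`pre_pre`. -/
theorem MultiAdditive.listDeriv_comm {F : List A → A} (h : MultiAdditive F) (x y : A)
    (l : List A) :
    ComPreLieRing.listDeriv x (ComPreLieRing.listDeriv y F) l
        + ComPreLieRing.listDeriv (pre y x) F l =
      ComPreLieRing.listDeriv y (ComPreLieRing.listDeriv x F) l
        + ComPreLieRing.listDeriv (pre x y) F l := by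
  induction l generalizing F with
  | nil => simp [ComPreLieRing.listDeriv]
  | cons c l ih =>
    have e : F (pre (pre c x) y :: l) + F (pre c (pre y x) :: l) =
        F (pre (pre c y) x :: l) + F (pre c (pre x y) :: l) := by
      rw [← h.head, ← h.head]
      congr 2
      have := pre_pre c x y
      linear_combination this
    have := ih (h.tail c)
    simp only [ComPreLieRing.listDeriv, listDeriv_add]
    linear_combination e + this

/-- The symmetric brace of `a` with a list of length `n`, and zero on the other lists. -/
def braceList (a : A) : ℕ → List A → A
  | 0, [] => a
  | 0, _ :: _ => 0
  | _ + 1, [] => 0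
  -- The length is a separate argument because `listDeriv` evaluates the previous brace at modified
  -- lists, which are not sublists of `l`.
  | n + 1, x :: l => pre (braceList a n l) x - listDeriv x (braceList a n) l

theorem multiAdditive_braceList (a : A) (n : ℕ) : MultiAdditive (braceList a n) := by
  induction n with
  | zero => rintro (_ | ⟨c, l₁⟩) u v l₂ <;> simp [braceList]
  | succ n ih =>
    rintro (_ | ⟨c, l₁⟩) u v l₂
    · simp only [List.nil_append, braceList, pre_add, ih.listDeriv_add_left]
      abel
    · simp only [List.cons_append, braceList]
      rw [ih, ih.listDeriv]
      simp only [add_pre]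
      abel

/-- Only the exchange of the first two entries needs an argument: after expanding the recursion
twice, the antisymmetric part is the preLie identity for the shorter brace minus the identity
`listDeriv_comm` for the action on entries. -/
theorem permInvariant_braceList (a : A) (n : ℕ) : PermInvariant (braceList a n) := by
  induction n with
  | zero =>
    rintro (_ | ⟨x, l⟩) (_ | ⟨y, l'⟩) h
    · rfl
    · simp at h
    · simp at h
    · rfl
  | succ n ih =>
    intro l l' hl
    induction hl with
    | nil => rfl
    | cons x hl _ => simp only [braceList, ih _ _ hl, ih.listDeriv x _ _ hl]
    | trans _ _ h h' => exact h.trans h'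
    | swap x y l =>
      cases n with
      -- A list with at least two entries is too long for index `1`: both sides vanish.
      | zero => simp [braceList, listDeriv, listDeriv_zero, zero_pre]
      | succ n =>
        have hm := multiAdditive_braceList a n
        have h₁ := hm.listDeriv_comm x y l
        have h₂ := pre_pre (braceList a n l) x y
        simp only [braceList, listDeriv, listDeriv_sub, listDeriv_pre, sub_pre]
        linear_combination h₂ - h₁

/-- The symmetric brace of `a` with a multiset. -/
def brace (a : A) (M : Multiset A) : A :=
  Quot.lift (fun l => braceList a l.length l)
    (fun l l' h => by
      rw [List.Perm.length_eq h, permInvariant_braceList a _ _ _ h]) M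

theorem brace_add_cons (a u v : A) (M : Multiset A) :
    brace a ((u + v) ::ₘ M) = brace a (u ::ₘ M) + brace a (v ::ₘ M) := by
  induction M using Quotient.inductionOn with
  | _ l => exact (multiAdditive_braceList a (l.length + 1)).head u v l

/-- The brace as an additive map of one of its entries. -/
def braceHom (a : A) (M : Multiset A) : A →+ A :=
  AddMonoidHom.mk' (fun u => brace a (u ::ₘ M)) fun u v => brace_add_cons a u v M

theorem brace_zero_cons (a : A) (M : Multiset A) : brace a (0 ::ₘ M) = 0 :=
  map_zero (braceHom a M)

theorem brace_sum_cons {ι : Type*} (a : A) (M : Multiset A) (s : Finset ι) (f : ι → A) :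
    ∑ i ∈ s, brace a (f i ::ₘ M) = brace a ((∑ i ∈ s, f i) ::ₘ M) :=
  (map_sum (braceHom a M) f s).symm

-- Symmetry lets the modified entry be moved to the front, so the sum can be written in terms of the
-- multiset alone.
open Classical in
theorem PermInvariant.listDeriv_eq {F : List A → A} (h : PermInvariant F) (x : A) (l : List A) :
    ComPreLieRing.listDeriv x F l = (l.map fun m => F (pre m x :: l.erase m)).sum := by
  induction l generalizing F with
  | nil => rfl
  | cons c l ih =>
    simp only [ComPreLieRing.listDeriv, ih (h.tail c), List.map_cons, List.sum_cons,
      List.erase_cons_head]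
    congr 2
    refine List.map_congr_left fun m hm => ?_
    refine h _ _ ?_
    refine (List.Perm.swap _ _ _).trans (List.Perm.cons _ ?_)
    by_cases hc : c = m
    · subst hc
      rw [List.erase_cons_head]
      exact (List.perm_cons_erase hm).symm
    · rw [List.erase_cons_tail (by simpa using hc)]

open Classical in
theorem brace_cons (a x : A) (M : Multiset A) :
    brace a (x ::ₘ M) =
      pre (brace a M) x - (M.map fun m => brace a (pre m x ::ₘ M.erase m)).sum := by
  induction M using Quotient.inductionOn with
  | _ l =>
    change pre (braceList a l.length l) x - listDeriv x (braceList a l.length) l = _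
    rw [(permInvariant_braceList a _).listDeriv_eq]
    congr 1
    change _ = (l.map fun m => brace a (pre m x ::ₘ ((l : Multiset A).erase m))).sum
    congr 1
    refine List.map_congr_left fun m hm => ?_
    change _ = braceList a ((l.erase m).length + 1) (pre m x :: l.erase m)
    rw [List.length_erase_of_mem hm, Nat.sub_add_cancel (List.length_pos_of_mem hm)]

open Classical in
/-- The recursion for the brace of an indexed family together with entries killed by
`· • x`. -/
theorem pre_brace {ι : Type*} [DecidableEq ι] (a x : A) (E : Multiset A) (hE : ∀ e ∈ E, pre e x = 0)
    (s : Finset ι) (f : ι → A) :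
    pre (brace a (E + s.val.map f)) x = brace a (x ::ₘ (E + s.val.map f)) +
      ∑ i ∈ s, brace a (pre (f i) x ::ₘ (E + (s.erase i).val.map f)) := by
  rw [brace_cons, Multiset.map_add, Multiset.sum_add]
  have h₀ : (E.map fun m => brace a (pre m x ::ₘ (E + s.val.map f).erase m)).sum = 0 := by
    refine Multiset.sum_eq_zero fun y hy => ?_
    obtain ⟨e, he, rfl⟩ := Multiset.mem_map.1 hy
    rw [hE e he, brace_zero_cons]
  rw [h₀, zero_add, Multiset.map_map]
  have h₁ : (s.val.map ((fun m => brace a (pre m x ::ₘ (E + s.val.map f).erase m)) ∘ f)).sum =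
      ∑ i ∈ s, brace a (pre (f i) x ::ₘ (E + (s.erase i).val.map f)) := by
    refine Finset.sum_congr rfl fun i hi => ?_
    have : E + s.val.map f = f i ::ₘ (E + (s.erase i).val.map f) := by
      conv_lhs => rw [← Finset.insert_erase hi]
      rw [Finset.insert_val_of_notMem (Finset.notMem_erase i s), Multiset.map_cons,
        Multiset.add_cons]
    simp only [Function.comp, this, Multiset.erase_cons_head]
  rw [h₁, sub_add_cancel]

end ComPreLieRing

/-! ### Ancestors in a finite forest -/

namespace PartitionedForest

variable {D : Type u} (T : PartitionedForest D)

/-- `T.IsAncestor s x`: the vertex `s` is `x` or an iterated ascendant of `x`. -/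
def IsAncestor : T.V → T.V → Prop := Relation.ReflTransGen fun y x => T.parent x = some y

variable {T}

theorem IsAncestor.refl (x : T.V) : T.IsAncestor x x := Relation.ReflTransGen.refl

theorem IsAncestor.tail {s x y : T.V} (h : T.IsAncestor s x) (hy : T.parent y = some x) :
    T.IsAncestor s y := Relation.ReflTransGen.tail h hy

theorem IsAncestor.eq_or {s y : T.V} (h : T.IsAncestor s y) :
    y = s ∨ ∃ x, T.IsAncestor s x ∧ T.parent y = some x :=
  Relation.ReflTransGen.cases_tail h

theorem IsAncestor.of_parent {s x y : T.V} (h : T.IsAncestor s y) (hs : s ≠ y)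
    (hy : T.parent y = some x) : T.IsAncestor s x := by
  obtain h | ⟨z, hz, hyz⟩ := h.eq_or
  · exact absurd h.symm hs
  · rw [hy, Option.some.injEq] at hyz
    exact hyz ▸ hz

theorem IsAncestor.eq_of_root {s x : T.V} (h : T.IsAncestor s x) (hx : T.parent x = none) :
    s = x := by
  obtain h | ⟨z, _, hz⟩ := h.eq_or
  · exact h.symm
  · simp [hx] at hz

theorem not_isAncestor_of_parent {x y : T.V} (hy : T.parent y = some x) : ¬ T.IsAncestor y x := by
  intro h
  have h' : Relation.TransGen (fun y x => T.parent x = some y) y y :=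
    Relation.TransGen.tail' h hy
  exact (T.wf.transGen.irrefl).irrefl y h'

/-- Two ancestors of one vertex are comparable, as ascendants are unique, and comparable siblings
coincide, as there are no cycles. Hence the branches below distinct siblings are disjoint. -/
theorem IsAncestor.eq_of_siblings {s t t' : T.V} (h : T.IsAncestor t s) (h' : T.IsAncestor t' s)
    (e : T.parent t = T.parent t') : t = t' := by
  have key : ∀ {t t' : T.V}, T.parent t = T.parent t' → T.IsAncestor t t' → t = t' := by
    intro t t' e h
    by_contra hne
    cases hx : T.parent t' with
    | none => exact hne (h.eq_of_root hx)
    | some x => exact not_isAncestor_of_parent (e.trans hx) (h.of_parent hne hx)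
  have ht : T.IsAncestor t t' ∨ T.IsAncestor t' t := by
    induction h with
    | refl => exact Or.inr h'
    | @tail y z h₁ h₂ ih =>
      by_cases hz : t' = z
      · subst hz
        exact Or.inl (IsAncestor.tail h₁ h₂)
      · exact ih (h'.of_parent hz h₂)
  exact ht.elim (key e) fun h => (key e.symm h).symm

theorem exists_root_isAncestor (x : T.V) : ∃ r, T.parent r = none ∧ T.IsAncestor r x := by
  induction x using T.wf.induction with
  | _ x ih =>
    cases hx : T.parent x with
    | none => exact ⟨x, hx, .refl x⟩
    | some y =>
      obtain ⟨r, hr, h⟩ := ih y hx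
      exact ⟨r, hr, h.tail hx⟩

variable (T)

/-- The field `wf` excludes infinite ascending paths; finiteness also excludes infinite descending
ones, which permits recursion from the leaves to the roots. -/
theorem wellFounded_child : WellFounded fun y x => T.parent y = some x := by
  have : IsTrans T.V (Function.swap (Relation.TransGen fun y x => T.parent x = some y)) :=
    ⟨fun _ _ _ h h' => Relation.TransGen.trans h' h⟩
  have : Std.Irrefl (Function.swap (Relation.TransGen fun y x => T.parent x = some y)) :=
    ⟨fun x h => T.wf.transGen.irrefl.irrefl x h⟩
  refine Subrelation.wf (fun {x y} h => ?_)
    (Finite.wellFounded_of_trans_of_irrefl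
      (Function.swap (Relation.TransGen fun y x => T.parent x = some y)))
  exact Relation.TransGen.single (r := fun y x => T.parent x = some y) h

/-! ### Values of vertices and their variation -/

section Evaluation

open ComPreLieRing Finset

open Classical in
/-- The block of a vertex. -/
noncomputable def blockOf (x : T.V) : Finset T.V := univ.filter (T.block.r x)

open Classical in
/-- The direct descendants of a vertex. -/
noncomputable def children (x : T.V) : Finset T.V := univ.filter fun y => T.parent y = some x

open Classical in
/-- The roots. -/
noncomputable def roots : Finset T.V := univ.filter fun y => T.parent y = none

open Classical in
/-- The blocks of direct descendants of a vertex. -/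
noncomputable def childBlocks (x : T.V) : Finset (Finset T.V) := (T.children x).image T.blockOf

variable {T}

theorem mem_blockOf {x y : T.V} : y ∈ T.blockOf x ↔ T.block.r x y := by simp [blockOf]

theorem mem_children {x y : T.V} : y ∈ T.children x ↔ T.parent y = some x := by simp [children]

theorem mem_roots {x : T.V} : x ∈ T.roots ↔ T.parent x = none := by simp [roots]

theorem mem_childBlocks {x : T.V} {b : Finset T.V} :
    b ∈ T.childBlocks x ↔ ∃ y, T.parent y = some x ∧ T.blockOf y = b := by
  simp [childBlocks, mem_children]

theorem parent_of_mem_childBlocks {x y : T.V} {b : Finset T.V} (hb : b ∈ T.childBlocks x)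
    (hy : y ∈ b) : T.parent y = some x := by
  obtain ⟨z, hz, rfl⟩ := mem_childBlocks.1 hb
  rw [← hz]
  exact (T.parent_eq_of_block _ _ (mem_blockOf.1 hy)).symm

theorem blockOf_eq_of_mem_childBlocks {x y : T.V} {b : Finset T.V} (hb : b ∈ T.childBlocks x)
    (hy : y ∈ b) : T.blockOf y = b := by
  obtain ⟨z, hz, rfl⟩ := mem_childBlocks.1 hb
  have h := mem_blockOf.1 hy
  ext t
  rw [mem_blockOf, mem_blockOf]
  exact ⟨T.block.iseqv.trans h, T.block.iseqv.trans (T.block.iseqv.symm h)⟩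

variable {A : Type w} [ComPreLieRing A]

variable (T) in
open Classical in
/-- The value of a forest at a vertex `x`: the brace of `g x` with the entries `E x` and with the
products of values over the blocks of direct descendants of `x`. -/
noncomputable def val (g : T.V → A) (E : T.V → Multiset A) : T.V → A :=
  T.wellFounded_child.fix fun x ih =>
    brace (g x) (E x + (T.childBlocks x).val.map fun b =>
      -- The default `1` is never reached, since every member of a child block of `x` has ascendant
      -- `x`; the test only provides the proof that the recursion demands.
      ∏ t ∈ b, if h : T.parent t = some x then ih t h else 1)

theorem val_eq (g : T.V → A) (E : T.V → Multiset A) (x : T.V) :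
    T.val g E x = brace (g x)
      (E x + (T.childBlocks x).val.map fun b => ∏ t ∈ b, T.val g E t) := by
  rw [val, WellFounded.fix_eq]
  congr 2
  refine Multiset.map_congr rfl fun b hb => Finset.prod_congr rfl fun t ht => ?_
  rw [dif_pos (parent_of_mem_childBlocks hb ht)]

-- The value at `x` involves only the entries attached to `x` and its iterated descendants.
open Classical in
theorem val_update_of_not_isAncestor (g : T.V → A) (E : T.V → Multiset A) (m : Multiset A)
    (s x : T.V) (h : ¬ T.IsAncestor x s) :
    T.val g (Function.update E s m) x = T.val g E x := by
  induction x using T.wellFounded_child.induction with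
  | _ x ih =>
    rw [val_eq, val_eq, Function.update_of_ne (fun e => h (by subst e; exact .refl x))]
    congr 2
    refine Multiset.map_congr rfl fun b hb => Finset.prod_congr rfl fun t ht => ?_
    have := parent_of_mem_childBlocks hb ht
    exact ih t this fun h' => h (Relation.ReflTransGen.head this h')

open Classical in
/-- The iterated descendants of the vertices of `b`. -/
noncomputable def descendants (b : Finset T.V) : Finset T.V :=
  univ.filter fun s => ∃ t ∈ b, T.IsAncestor t s

theorem mem_descendants {b : Finset T.V} {s : T.V} :
    s ∈ descendants b ↔ ∃ t ∈ b, T.IsAncestor t s := by simp [descendants]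

open Classical in
theorem sum_descendants {b : Finset T.V}
    (hb : ∀ t ∈ b, ∀ t' ∈ b, T.parent t = T.parent t') (f : T.V → A) :
    ∑ s ∈ descendants b, f s = ∑ t ∈ b, ∑ s ∈ descendants {t}, f s := by
  rw [← Finset.sum_biUnion]
  · refine Finset.sum_congr ?_ fun _ _ => rfl
    ext s
    simp [mem_descendants]
  · intro t ht t' ht' hne
    refine Finset.disjoint_left.2 fun s hs hs' => hne ?_
    simp only [mem_descendants, Finset.mem_singleton, exists_eq_left] at hs hs'
    exact hs.eq_of_siblings hs' (hb t ht t' ht')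

open Classical in
/-- Variation of a product of values over siblings, given the variation of each value. -/
theorem sum_prod_val_update (g : T.V → A) (E : T.V → Multiset A) (c : A) {b : Finset T.V}
    (hb : ∀ t ∈ b, ∀ t' ∈ b, T.parent t = T.parent t')
    (ih : ∀ t ∈ b, ∑ s ∈ descendants {t}, T.val g (Function.update E s (c ::ₘ E s)) t =
      pre (T.val g E t) c) :
    ∑ s ∈ descendants b, ∏ t ∈ b, T.val g (Function.update E s (c ::ₘ E s)) t =
      pre (∏ t ∈ b, T.val g E t) c := by
  rw [sum_descendants hb, prod_pre]
  refine Finset.sum_congr rfl fun t ht => ?_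
  rw [← ih t ht, Finset.sum_mul]
  refine Finset.sum_congr rfl fun s hs => ?_
  rw [← Finset.mul_prod_erase b _ ht]
  congr 1
  -- A vertex `s` below `t` is not below any other sibling, so the remaining factors do not see the
  -- new entry.
  refine Finset.prod_congr rfl fun t' ht' => ?_
  refine val_update_of_not_isAncestor _ _ _ _ _ fun h => Finset.ne_of_mem_erase ht' ?_
  simp only [mem_descendants, Finset.mem_singleton, exists_eq_left] at hs
  exact h.eq_of_siblings hs (hb _ (Finset.mem_of_mem_erase ht') _ ht)

open Classical in
theorem descendants_singleton (x : T.V) :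
    descendants {x} = insert x ((T.childBlocks x).biUnion descendants) := by
  ext s
  simp only [mem_descendants, Finset.mem_singleton, exists_eq_left, Finset.mem_insert,
    Finset.mem_biUnion, mem_childBlocks]
  constructor
  · intro h
    obtain h | ⟨t, ht, hs⟩ := Relation.ReflTransGen.cases_head h
    · exact Or.inl h.symm
    · exact Or.inr ⟨_, ⟨t, ht, rfl⟩, t, mem_blockOf.2 (T.block.iseqv.refl t), hs⟩
  · rintro (rfl | ⟨b, ⟨y, hy, rfl⟩, t, ht, hs⟩)
    · exact .refl _
    · refine Relation.ReflTransGen.head ?_ hs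
      exact (T.parent_eq_of_block _ _ (mem_blockOf.1 ht)).symm.trans hy

-- By `pre_brace`, acting by `c` on the brace at `x` either adds `c` as an entry at `x`, which is
-- the term `s = x`, or acts on the entry of a child block. The latter spreads over the vertices
-- below that block by the Leibniz rule and induction. The hypothesis `hE` removes the action on the
-- entries `E x`.
open Classical in
theorem sum_val_update (g : T.V → A) (E : T.V → Multiset A) (c : A)
    (hE : ∀ x, ∀ e ∈ E x, pre e c = 0) (x : T.V) :
    ∑ s ∈ descendants {x}, T.val g (Function.update E s (c ::ₘ E s)) x =
      pre (T.val g E x) c := by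
  induction x using T.wellFounded_child.induction with
  | _ x ih =>
    have hsib : ∀ b ∈ T.childBlocks x, ∀ t ∈ b, ∀ t' ∈ b, T.parent t = T.parent t' :=
      fun b hb t ht t' ht' => (parent_of_mem_childBlocks hb ht).trans
        (parent_of_mem_childBlocks hb ht').symm
    -- Branches below distinct child blocks are disjoint, so a new entry at `s` alters one entry of
    -- the brace at `x` only.
    have hdisj : ∀ b ∈ T.childBlocks x, ∀ b' ∈ T.childBlocks x, ∀ s ∈ descendants b,
        ∀ t ∈ b', T.IsAncestor t s → b' = b := by
      intro b hb b' hb' s hs t ht hts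
      obtain ⟨t', ht', hs'⟩ := mem_descendants.1 hs
      have e := hts.eq_of_siblings hs' ((parent_of_mem_childBlocks hb' ht).trans
        (parent_of_mem_childBlocks hb ht').symm)
      rw [← blockOf_eq_of_mem_childBlocks hb ht', ← blockOf_eq_of_mem_childBlocks hb' ht, e]
    have hx : x ∉ (T.childBlocks x).biUnion descendants := by
      intro h
      obtain ⟨b, hb, h⟩ := Finset.mem_biUnion.1 h
      obtain ⟨t, ht, h⟩ := mem_descendants.1 h
      exact not_isAncestor_of_parent (parent_of_mem_childBlocks hb ht) h
    rw [descendants_singleton, Finset.sum_insert hx, Finset.sum_biUnion, val_eq g E x,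
      pre_brace _ _ _ (hE x)]
    · congr 1
      · rw [val_eq, Function.update_self, Multiset.cons_add]
        congr 3
        refine Multiset.map_congr rfl fun b hb => Finset.prod_congr rfl fun t ht => ?_
        exact val_update_of_not_isAncestor _ _ _ _ _
          (not_isAncestor_of_parent (parent_of_mem_childBlocks hb ht))
      · refine Finset.sum_congr rfl fun b hb => ?_
        rw [← sum_prod_val_update g E c (hsib b hb)
          fun t ht => ih t (parent_of_mem_childBlocks hb ht), ← brace_sum_cons]
        refine Finset.sum_congr rfl fun s hs => ?_
        have hsx : x ≠ s := by
          rintro rfl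
          exact hx (Finset.mem_biUnion.2 ⟨b, hb, hs⟩)
        rw [val_eq, Function.update_of_ne hsx]
        conv_lhs => rw [← Finset.insert_erase hb]
        rw [Finset.insert_val_of_notMem (Finset.notMem_erase _ _), Multiset.map_cons,
          Multiset.add_cons]
        congr 2
        refine congrArg (_ + ·) (Multiset.map_congr rfl fun b' hb' =>
          Finset.prod_congr rfl fun t ht => ?_)
        refine val_update_of_not_isAncestor _ _ _ _ _ fun h => ?_
        exact Finset.ne_of_mem_erase hb'
          (hdisj b hb b' (Finset.mem_of_mem_erase hb') s hs t ht h)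
    · intro b hb b' hb' hne
      refine Finset.disjoint_left.2 fun s hs hs' => hne ?_
      obtain ⟨t, ht, h⟩ := mem_descendants.1 hs
      exact hdisj b' hb' b hb s hs' t ht h

-- Every vertex lies below a root, so the descendants of the roots are all the vertices.
open Classical in
theorem sum_prod_roots_val_update (g : T.V → A) (E : T.V → Multiset A) (c : A)
    (hE : ∀ x, ∀ e ∈ E x, pre e c = 0) :
    ∑ s, ∏ t ∈ T.roots, T.val g (Function.update E s (c ::ₘ E s)) t =
      pre (∏ t ∈ T.roots, T.val g E t) c := by
  rw [← sum_prod_val_update g E c (fun t ht t' ht' => (mem_roots.1 ht).trans (mem_roots.1 ht').symm)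
    fun t _ => sum_val_update g E c hE t]
  refine Finset.sum_congr ?_ fun _ _ => rfl
  ext s
  simp only [Finset.mem_univ, true_iff, mem_descendants, mem_roots]
  exact exists_root_isAncestor s

end Evaluation

end PartitionedForest

/-! ### Isomorphisms between iterated operations on trees -/

namespace PartitionedTree

variable {D : Type u}

theorem mul_comm_equiv (T T' : PartitionedTree D) : T.mul T' ≈ T'.mul T := by
  refine ⟨⟨Equiv.sumComm T.V T'.V, ?_, ?_, ?_⟩⟩
  · rintro (x | x)
    · change (T.parent x).map Sum.inr = ((T.parent x).map Sum.inl).map Sum.swap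
      cases T.parent x <;> rfl
    · change (T'.parent x).map Sum.inl = ((T'.parent x).map Sum.inr).map Sum.swap
      cases T'.parent x <;> rfl
  · rintro (x | x) (y | y) <;> exact Iff.rfl
  · rintro (x | x) <;> rfl

theorem mul_assoc_equiv (T T' T'' : PartitionedTree D) :
    (T.mul T').mul T'' ≈ T.mul (T'.mul T'') := by
  refine ⟨⟨Equiv.sumAssoc T.V T'.V T''.V, ?_, ?_, ?_⟩⟩
  · rintro ((x | x) | x)
    · change (T.parent x).map Sum.inl = (((T.parent x).map Sum.inl).map Sum.inl).map _
      cases T.parent x <;> rfl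
    · change ((T'.parent x).map Sum.inl).map Sum.inr =
        (((T'.parent x).map Sum.inr).map Sum.inl).map _
      cases T'.parent x <;> rfl
    · change ((T''.parent x).map Sum.inr).map Sum.inr = ((T''.parent x).map Sum.inr).map _
      cases T''.parent x <;> rfl
  · rintro ((x | x) | x) ((y | y) | y)
    · exact Iff.rfl
    · change (T.parent x = none ∧ (T'.parent y).map Sum.inl = none) ↔
        (T.parent x = none ∧ T'.parent y = none)
      simp
    · change (T.parent x = none ∧ (T''.parent y).map Sum.inr = none) ↔
        ((T.parent x).map Sum.inl = none ∧ T''.parent y = none)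
      simp
    · change ((T'.parent x).map Sum.inl = none ∧ T.parent y = none) ↔
        (T'.parent x = none ∧ T.parent y = none)
      simp
    · exact Iff.rfl
    · change (T'.parent x = none ∧ T''.parent y = none) ↔
        ((T'.parent x).map Sum.inr = none ∧ T''.parent y = none)
      simp
    · change ((T''.parent x).map Sum.inr = none ∧ T.parent y = none) ↔
        (T''.parent x = none ∧ (T.parent y).map Sum.inl = none)
      simp
    · change (T''.parent x = none ∧ T'.parent y = none) ↔
        (T''.parent x = none ∧ (T'.parent y).map Sum.inr = none)
      simp
    · exact Iff.rfl
  · rintro ((x | x) | x) <;> rfl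

theorem empty_mul_equiv (T : PartitionedTree D) : (empty D).mul T ≈ T := by
  refine ⟨⟨Equiv.emptySum Empty T.V, ?_, ?_, ?_⟩⟩
  · rintro (x | x)
    · exact x.elim
    · change T.parent x = ((T.parent x).map Sum.inr).map _
      cases T.parent x <;> rfl
  · rintro (x | x) (y | y)
    · exact x.elim
    · exact x.elim
    · exact y.elim
    · exact Iff.rfl
  · rintro (x | x)
    · exact x.elim
    · rfl

theorem equiv_empty (T : PartitionedTree D) [IsEmpty T.V] : T ≈ empty D :=
  ⟨⟨Equiv.equivOfIsEmpty T.V Empty, fun x => isEmptyElim x, fun x => isEmptyElim x,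
    fun x => isEmptyElim x⟩⟩

/-- The roots of `S` acquire an ascendant, so joining the blocks of roots of `T` and `T'` leaves
their block alone, before or after the grafting. -/
theorem graft_mul_inl_equiv (T T' S : PartitionedTree D) (s : T.V) :
    (T.mul T').graft (.inl s) S ≈ (T.graft s S).mul T' := by
  refine ⟨⟨(Equiv.sumAssoc T.V T'.V S.V).trans (((Equiv.refl _).sumCongr
    (Equiv.sumComm T'.V S.V)).trans (Equiv.sumAssoc T.V S.V T'.V).symm), ?_, ?_, ?_⟩⟩
  · rintro ((x | x) | x)
    · change ((T.parent x).map Sum.inl).map Sum.inl =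
        (((T.parent x).map Sum.inl).map Sum.inl).map _
      cases T.parent x <;> rfl
    · change (T'.parent x).map Sum.inr = (((T'.parent x).map Sum.inr).map Sum.inl).map _
      cases T'.parent x <;> rfl
    · change (some ((S.parent x).elim (Sum.inl s) Sum.inr)).map Sum.inl =
        (some ((S.parent x).elim (Sum.inl (Sum.inl s)) Sum.inr)).map _
      cases S.parent x <;> rfl
  · rintro ((x | x) | x) ((y | y) | y)
    · exact Iff.rfl
    · change ((T.parent x).map Sum.inl = none ∧ T'.parent y = none) ↔
        (T.parent x = none ∧ T'.parent y = none)
      simp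
    · exact Iff.rfl
    · change (T'.parent x = none ∧ (T.parent y).map Sum.inl = none) ↔
        (T'.parent x = none ∧ T.parent y = none)
      simp
    · exact Iff.rfl
    · exact iff_of_false (by rintro ⟨_, h⟩; cases h) id
    · exact Iff.rfl
    · exact iff_of_false (by rintro ⟨h, _⟩; cases h) id
    · exact Iff.rfl
  · rintro ((x | x) | x) <;> rfl

theorem graft_mul_inr_equiv (T T' S : PartitionedTree D) (s : T'.V) :
    (T.mul T').graft (.inr s) S ≈ T.mul (T'.graft s S) := by
  refine ⟨⟨Equiv.sumAssoc T.V T'.V S.V, ?_, ?_, ?_⟩⟩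
  · rintro ((x | x) | x)
    · change (T.parent x).map Sum.inl = (((T.parent x).map Sum.inl).map Sum.inl).map _
      cases T.parent x <;> rfl
    · change ((T'.parent x).map Sum.inl).map Sum.inr =
        (((T'.parent x).map Sum.inr).map Sum.inl).map _
      cases T'.parent x <;> rfl
    · change (some ((S.parent x).elim (Sum.inl s) Sum.inr)).map Sum.inr =
        (some ((S.parent x).elim (Sum.inl (Sum.inr s)) Sum.inr)).map _
      cases S.parent x <;> rfl
  · rintro ((x | x) | x) ((y | y) | y)
    · exact Iff.rfl
    · change (T.parent x = none ∧ (T'.parent y).map Sum.inl = none) ↔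
        (T.parent x = none ∧ T'.parent y = none)
      simp
    · exact iff_of_false (by rintro ⟨_, h⟩; cases h) id
    · change ((T'.parent x).map Sum.inl = none ∧ T.parent y = none) ↔
        (T'.parent x = none ∧ T.parent y = none)
      simp
    · exact Iff.rfl
    · exact Iff.rfl
    · exact iff_of_false (by rintro ⟨h, _⟩; cases h) id
    · exact Iff.rfl
    · exact Iff.rfl
  · rintro ((x | x) | x) <;> rfl

/-- Graftings on vertices of `T` commute, even at the same vertex, because each grafted tree keeps
its own block of roots. This is the symmetry behind the preLie identity. -/
theorem graft_graft_inl_equiv (T S S' : PartitionedTree D) (s t : T.V) :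
    (T.graft s S).graft (.inl t) S' ≈ (T.graft t S').graft (.inl s) S := by
  refine ⟨⟨(Equiv.sumAssoc T.V S.V S'.V).trans (((Equiv.refl _).sumCongr
    (Equiv.sumComm S.V S'.V)).trans (Equiv.sumAssoc T.V S'.V S.V).symm), ?_, ?_, ?_⟩⟩
  · rintro ((x | x) | x)
    · change ((T.parent x).map Sum.inl).map Sum.inl =
        (((T.parent x).map Sum.inl).map Sum.inl).map _
      cases T.parent x <;> rfl
    · change some ((S.parent x).elim (Sum.inl (Sum.inl s)) Sum.inr) =
        ((some ((S.parent x).elim (Sum.inl s) Sum.inr)).map Sum.inl).map _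
      cases S.parent x <;> rfl
    · change (some ((S'.parent x).elim (Sum.inl t) Sum.inr)).map Sum.inl =
        (some ((S'.parent x).elim (Sum.inl (Sum.inl t)) Sum.inr)).map _
      cases S'.parent x <;> rfl
  · rintro ((x | x) | x) ((y | y) | y) <;> exact Iff.rfl
  · rintro ((x | x) | x) <;> rfl

theorem graft_graft_inr_equiv (T S S' : PartitionedTree D) (s : T.V) (t : S.V) :
    (T.graft s S).graft (.inr t) S' ≈ T.graft s (S.graft t S') := by
  refine ⟨⟨Equiv.sumAssoc T.V S.V S'.V, ?_, ?_, ?_⟩⟩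
  · rintro ((x | x) | x)
    · change (T.parent x).map Sum.inl = (((T.parent x).map Sum.inl).map Sum.inl).map _
      cases T.parent x <;> rfl
    · change some (((S.parent x).map Sum.inl).elim (Sum.inl s) Sum.inr) =
        ((some ((S.parent x).elim (Sum.inl s) Sum.inr)).map Sum.inl).map _
      cases S.parent x <;> rfl
    · change some ((some ((S'.parent x).elim (Sum.inl t) Sum.inr)).elim (Sum.inl s) Sum.inr) =
        (some ((S'.parent x).elim (Sum.inl (Sum.inr t)) Sum.inr)).map _
      cases S'.parent x <;> rfl
  · rintro ((x | x) | x) ((y | y) | y) <;> exact Iff.rfl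
  · rintro ((x | x) | x) <;> rfl

section Raise

variable (T T' : PartitionedTree (ℕ × D))

theorem raise_mul_inl_equiv (s : T.V) :
    (T.mul T').raise (.inl s) ≈ (T.raise s).mul T' := by
  refine ⟨⟨Equiv.refl _, ?_, ?_, ?_⟩⟩
  · rintro (x | x)
    · exact (congrFun Option.map_id _).symm
    · exact (congrFun Option.map_id _).symm
  · rintro (x | x) (y | y) <;> exact Iff.rfl
  · rintro (x | x)
    · by_cases h : x = s
      · exact (if_pos h).trans (if_pos (congrArg Sum.inl h)).symm
      · exact (if_neg h).trans (if_neg fun h' => h (Sum.inl.inj h')).symm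
    · exact (if_neg (by simp)).symm

theorem raise_mul_inr_equiv (s : T'.V) :
    (T.mul T').raise (.inr s) ≈ T.mul (T'.raise s) := by
  refine ⟨⟨Equiv.refl _, ?_, ?_, ?_⟩⟩
  · rintro (x | x)
    · exact (congrFun Option.map_id _).symm
    · exact (congrFun Option.map_id _).symm
  · rintro (x | x) (y | y) <;> exact Iff.rfl
  · rintro (x | x)
    · exact (if_neg (by simp)).symm
    · by_cases h : x = s
      · exact (if_pos h).trans (if_pos (congrArg Sum.inr h)).symm
      · exact (if_neg h).trans (if_neg fun h' => h (Sum.inr.inj h')).symm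

theorem raise_graft_inl_equiv (s t : T.V) :
    (T.graft s T').raise (.inl t) ≈ (T.raise t).graft s T' := by
  refine ⟨⟨Equiv.refl _, ?_, ?_, ?_⟩⟩
  · rintro (x | x)
    · exact (congrFun Option.map_id _).symm
    · exact (congrFun Option.map_id _).symm
  · rintro (x | x) (y | y) <;> exact Iff.rfl
  · rintro (x | x)
    · by_cases h : x = t
      · exact (if_pos h).trans (if_pos (congrArg Sum.inl h)).symm
      · exact (if_neg h).trans (if_neg fun h' => h (Sum.inl.inj h')).symm
    · exact (if_neg (by simp)).symm

theorem raise_graft_inr_equiv (s : T.V) (t : T'.V) :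
    (T.graft s T').raise (.inr t) ≈ T.graft s (T'.raise t) := by
  refine ⟨⟨Equiv.refl _, ?_, ?_, ?_⟩⟩
  · rintro (x | x)
    · exact (congrFun Option.map_id _).symm
    · exact (congrFun Option.map_id _).symm
  · rintro (x | x) (y | y) <;> exact Iff.rfl
  · rintro (x | x)
    · exact (if_neg (by simp)).symm
    · by_cases h : x = t
      · exact (if_pos h).trans (if_pos (congrArg Sum.inr h)).symm
      · exact (if_neg h).trans (if_neg fun h' => h (Sum.inr.inj h')).symm

end Raise

end PartitionedTree

/-! ### The Com-PreLie axioms for trees and their linear extension -/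

namespace UCP

variable (K : Type v) [Field K] {D : Type u}

open PartitionedTree

theorem tree_eq_of_equiv {T T' : PartitionedTree (ℕ × D)} (h : T ≈ T') : tree K T = tree K T' :=
  congrArg (fun t => Finsupp.single t (1 : K)) (Quotient.sound h)

theorem mul_tree (T T' : PartitionedTree (ℕ × D)) :
    mul K D (tree K T) (tree K T') = tree K (T.mul T') := by
  simp [mul, tree]
  rfl

theorem pre_tree (T T' : PartitionedTree (ℕ × D)) :
    pre K D (tree K T) (tree K T') = preTree K T T' := by
  simp [pre, tree]
  rfl

theorem pre_tree_of_isEmpty (T T' : PartitionedTree (ℕ × D)) [h : IsEmpty T'.V] :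
    pre K D (tree K T) (tree K T') = ∑ s : T.V, tree K (T.raise s) := by
  rw [pre_tree, preTree, if_pos h]

theorem pre_tree_of_nonempty (T T' : PartitionedTree (ℕ × D)) [h : Nonempty T'.V] :
    pre K D (tree K T) (tree K T') = ∑ s : T.V, tree K (T.graft s T') := by
  rw [pre_tree, preTree, if_neg (not_isEmpty_iff.2 h)]

/-- Two linear maps that agree on trees are equal. -/
theorem hom_ext {M : Type w} [AddCommGroup M] [Module K M] {f g : UCP K D →ₗ[K] M}
    (h : ∀ T, f (tree K T) = g (tree K T)) : f = g := by
  refine Finsupp.lhom_ext' fun t => ?_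
  induction t using Quotient.inductionOn with
  | _ T => exact LinearMap.ext_ring (h T)

theorem induction_tree {P : UCP K D → Prop} (x : UCP K D) (h₀ : P 0)
    (add : ∀ x y, P x → P y → P (x + y)) (smul : ∀ (c : K) x, P x → P (c • x))
    (tree : ∀ T, P (tree K T)) : P x := by
  induction x using Finsupp.induction_linear with
  | zero => exact h₀
  | add x y hx hy => exact add x y hx hy
  | single t c =>
    induction t using Quotient.inductionOn with
    | _ T =>
      have := smul c _ (tree T)
      rwa [UCP.tree, Finsupp.smul_single, smul_eq_mul, mul_one] at this

theorem tree_leibniz (T T' S : PartitionedTree (ℕ × D)) :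
    pre K D (mul K D (tree K T) (tree K T')) (tree K S) =
      mul K D (pre K D (tree K T) (tree K S)) (tree K T') +
        mul K D (tree K T) (pre K D (tree K T') (tree K S)) := by
  rw [mul_tree]
  rcases isEmpty_or_nonempty S.V with h | h
  · simp only [pre_tree_of_isEmpty, map_sum, LinearMap.sum_apply, mul_tree]
    refine (Fintype.sum_sum_type _).trans (congrArg₂ _ ?_ ?_)
    · exact Finset.sum_congr rfl fun s _ => tree_eq_of_equiv K (raise_mul_inl_equiv T T' s)
    · exact Finset.sum_congr rfl fun s _ => tree_eq_of_equiv K (raise_mul_inr_equiv T T' s)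
  · simp only [pre_tree_of_nonempty, map_sum, LinearMap.sum_apply, mul_tree]
    refine (Fintype.sum_sum_type _).trans (congrArg₂ _ ?_ ?_)
    · exact Finset.sum_congr rfl fun s _ => tree_eq_of_equiv K (graft_mul_inl_equiv T T' S s)
    · exact Finset.sum_congr rfl fun s _ => tree_eq_of_equiv K (graft_mul_inr_equiv T T' S s)

instance nonempty_graft (T S : PartitionedTree D) (s : T.V) [h : Nonempty S.V] :
    Nonempty (T.graft s S).V := h.map Sum.inr

instance nonempty_raise (T : PartitionedTree (ℕ × D)) (s : T.V) :
    Nonempty (T.raise s).V := ⟨s⟩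

/-- Grafting `S'` on a vertex of `S` before or after grafting `S` gives the same tree, so these
terms cancel in the associator. -/
theorem tree_preLie_nonempty (T S S' : PartitionedTree (ℕ × D)) [Nonempty S.V] [Nonempty S'.V] :
    pre K D (pre K D (tree K T) (tree K S)) (tree K S') -
        pre K D (tree K T) (pre K D (tree K S) (tree K S')) =
      ∑ s : T.V, ∑ t : T.V, tree K ((T.graft s S).graft (.inl t) S') := by
  simp only [pre_tree_of_nonempty, map_sum, LinearMap.sum_apply]
  rw [sub_eq_iff_eq_add, Finset.sum_comm (s := (Finset.univ : Finset S.V)),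
    ← Finset.sum_add_distrib]
  refine Finset.sum_congr rfl fun s _ => ?_
  refine (Fintype.sum_sum_type _).trans (congrArg₂ _ rfl ?_)
  exact Finset.sum_congr rfl fun t _ => tree_eq_of_equiv K (graft_graft_inr_equiv T S S' s t)

/-- The product `∅ • S` is an empty sum. Raising a vertex of `T` commutes with grafting `S`, and
raising a vertex of `S` cancels against `T • (S • ∅)`. -/
theorem tree_preLie_nonempty_empty (T S S' : PartitionedTree (ℕ × D)) [Nonempty S.V]
    [IsEmpty S'.V] :
    pre K D (pre K D (tree K T) (tree K S)) (tree K S') -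
        pre K D (tree K T) (pre K D (tree K S) (tree K S')) =
      pre K D (pre K D (tree K T) (tree K S')) (tree K S) -
        pre K D (tree K T) (pre K D (tree K S') (tree K S)) := by
  have h : pre K D (tree K S') (tree K S) = 0 := by simp [pre_tree_of_nonempty]
  rw [h, map_zero, sub_zero]
  simp only [pre_tree_of_nonempty, pre_tree_of_isEmpty, map_sum, LinearMap.sum_apply]
  rw [sub_eq_iff_eq_add, Finset.sum_comm (s := (Finset.univ : Finset S.V))]
  change _ = (∑ t : T.V, ∑ s : T.V, tree K ((T.raise t).graft s S)) + _
  rw [Finset.sum_comm (s := (Finset.univ : Finset T.V)) (t := (Finset.univ : Finset T.V)),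
    ← Finset.sum_add_distrib]
  refine Finset.sum_congr rfl fun s _ => ?_
  refine (Fintype.sum_sum_type _).trans (congrArg₂ _ ?_ ?_)
  · exact Finset.sum_congr rfl fun t _ => tree_eq_of_equiv K (raise_graft_inl_equiv T S s t)
  · exact Finset.sum_congr rfl fun t _ => tree_eq_of_equiv K (raise_graft_inr_equiv T S s t)

theorem tree_preLie (T S S' : PartitionedTree (ℕ × D)) :
    pre K D (pre K D (tree K T) (tree K S)) (tree K S') -
        pre K D (tree K T) (pre K D (tree K S) (tree K S')) =
      pre K D (pre K D (tree K T) (tree K S')) (tree K S) -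
        pre K D (tree K T) (pre K D (tree K S') (tree K S)) := by
  rcases isEmpty_or_nonempty S.V with h | h <;> rcases isEmpty_or_nonempty S'.V with h' | h'
  · rw [tree_eq_of_equiv K (Setoid.trans (equiv_empty S) (Setoid.symm (equiv_empty S')))]
  · exact (tree_preLie_nonempty_empty K T S' S).symm
  · exact tree_preLie_nonempty_empty K T S S'
  · rw [tree_preLie_nonempty, tree_preLie_nonempty, Finset.sum_comm]
    exact Finset.sum_congr rfl fun s _ => Finset.sum_congr rfl fun t _ =>
      tree_eq_of_equiv K (graft_graft_inl_equiv T S S' t s)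

variable (D)

theorem isUnitaryComPreLie : IsUnitaryComPreLie (mul K D) (pre K D) (one K D) where
  mul_comm a b := by
    have : mul K D = (mul K D).flip := by
      refine hom_ext K fun T => hom_ext K fun T' => ?_
      rw [LinearMap.flip_apply, mul_tree, mul_tree]
      exact tree_eq_of_equiv K (mul_comm_equiv T T')
    exact congrArg (fun f => f a b) this
  mul_assoc a b c := by
    induction a using induction_tree with
    | h₀ => simp
    | add x y hx hy => simp only [map_add, LinearMap.add_apply, hx, hy]
    | smul r x hx => simp only [map_smul, LinearMap.smul_apply, hx]
    | tree T =>
      induction b using induction_tree with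
      | h₀ => simp
      | add x y hx hy => simp only [map_add, LinearMap.add_apply, hx, hy]
      | smul r x hx => simp only [map_smul, LinearMap.smul_apply, hx]
      | tree T' =>
        induction c using induction_tree with
        | h₀ => simp
        | add x y hx hy => simp only [map_add, hx, hy]
        | smul r x hx => simp only [map_smul, hx]
        | tree T'' =>
          simp only [mul_tree]
          exact tree_eq_of_equiv K (mul_assoc_equiv T T' T'')
  one_mul a := by
    have : mul K D (one K D) = LinearMap.id := by
      refine hom_ext K fun T => ?_
      rw [one, mul_tree]
      exact tree_eq_of_equiv K (empty_mul_equiv T)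
    exact congrArg (fun f => f a) this
  preLie a b c := by
    induction a using induction_tree with
    | h₀ => simp
    | add x y hx hy =>
      simp only [map_add, LinearMap.add_apply, add_sub_add_comm, hx, hy]
    | smul r x hx => simp only [map_smul, LinearMap.smul_apply, ← smul_sub, hx]
    | tree T =>
      induction b using induction_tree with
      | h₀ => simp
      | add x y hx hy =>
        simp only [map_add, LinearMap.add_apply, add_sub_add_comm, hx, hy]
      | smul r x hx => simp only [map_smul, LinearMap.smul_apply, ← smul_sub, hx]
      | tree S =>
        induction c using induction_tree with
        | h₀ => simp
        | add x y hx hy =>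
          simp only [map_add, LinearMap.add_apply, add_sub_add_comm, hx, hy]
        | smul r x hx => simp only [map_smul, LinearMap.smul_apply, ← smul_sub, hx]
        | tree S' => exact tree_preLie K T S S'
  leibniz a b c := by
    induction a using induction_tree with
    | h₀ => simp
    | add x y hx hy =>
      simp only [map_add, LinearMap.add_apply, hx, hy]
      abel
    | smul r x hx => simp only [map_smul, LinearMap.smul_apply, ← smul_add, hx]
    | tree T =>
      induction b using induction_tree with
      | h₀ => simp
      | add x y hx hy =>
        simp only [map_add, LinearMap.add_apply, hx, hy]
        abel
      | smul r x hx => simp only [map_smul, LinearMap.smul_apply, ← smul_add, hx]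
      | tree T' =>
        induction c using induction_tree with
        | h₀ => simp
        | add x y hx hy =>
          simp only [map_add, LinearMap.add_apply, hx, hy]
          abel
        | smul r x hx => simp only [map_smul, LinearMap.smul_apply, ← smul_add, hx]
        | tree S => exact tree_leibniz K T T' S

end UCP

/-! ### Transport of values along embeddings of forests -/

namespace PartitionedForest

open ComPreLieRing Finset

open Classical in
/-- Comparison of values along an embedding of forests, where each vertex may have additional
blocks of direct descendants. -/
theorem val_embedding {D : Type u} {D' : Type v} {T : PartitionedForest D}
    {T' : PartitionedForest D'} {A : Type w} [ComPreLieRing A] (e : T.V ↪ T'.V)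
    (extra : T.V → Finset (Finset T'.V)) (g : T.V → A) (E : T.V → Multiset A) (g' : T'.V → A)
    (E' : T'.V → Multiset A)
    (hblocks : ∀ x, T'.childBlocks (e x) = (T.childBlocks x).image (Finset.map e) ∪ extra x)
    (hdisj : ∀ x, Disjoint ((T.childBlocks x).image (Finset.map e)) (extra x))
    (hg : ∀ x, g' (e x) = g x)
    (hE : ∀ x, E x = E' (e x) + (extra x).val.map fun b => ∏ t ∈ b, T'.val g' E' t) (x : T.V) :
    T'.val g' E' (e x) = T.val g E x := by
  induction x using T.wellFounded_child.induction with
  | _ x ih =>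
    rw [val_eq, val_eq, hg, hE, hblocks, ← Finset.disjUnion_eq_union _ _ (hdisj x),
      Finset.disjUnion_val, Multiset.map_add, add_assoc,
      add_comm (Multiset.map _ (extra x).val),
      Finset.image_val_of_injOn (Finset.map_injective e).injOn, Multiset.map_map]
    congr 3
    refine Multiset.map_congr rfl fun b hb => ?_
    rw [Function.comp, Finset.prod_map]
    exact Finset.prod_congr rfl fun t ht => ih t (parent_of_mem_childBlocks hb ht)

open Classical in
theorem childBlocks_embedding {D : Type u} {D' : Type v} {T : PartitionedForest D}
    {T' : PartitionedForest D'} (e : T.V ↪ T'.V) (x : T.V)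
    (hp : ∀ y, T'.parent y = some (e x) ↔ ∃ z, e z = y ∧ T.parent z = some x)
    (hb : ∀ y, T.parent y = some x → T'.blockOf (e y) = (T.blockOf y).map e) :
    T'.childBlocks (e x) = (T.childBlocks x).image (Finset.map e) := by
  ext b
  simp only [Finset.mem_image, mem_childBlocks]
  constructor
  · rintro ⟨y, hy, rfl⟩
    obtain ⟨z, rfl, hz⟩ := (hp y).1 hy
    exact ⟨_, ⟨z, hz, rfl⟩, (hb z hz).symm⟩
  · rintro ⟨_, ⟨y, hy, rfl⟩, rfl⟩
    exact ⟨e y, (hp _).2 ⟨y, rfl, hy⟩, hb y hy⟩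

theorem val_embedding_of_parent {D : Type u} {D' : Type v} {T : PartitionedForest D}
    {T' : PartitionedForest D'} {A : Type w} [ComPreLieRing A] (e : T.V ↪ T'.V)
    (g : T.V → A) (E : T.V → Multiset A) (g' : T'.V → A) (E' : T'.V → Multiset A)
    (hp : ∀ x y, T'.parent y = some (e x) ↔ ∃ z, e z = y ∧ T.parent z = some x)
    (hb : ∀ x y, T.parent y = some x → T'.blockOf (e y) = (T.blockOf y).map e)
    (hg : ∀ x, g' (e x) = g x) (hE : ∀ x, E' (e x) = E x) (x : T.V) :
    T'.val g' E' (e x) = T.val g E x := by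
  classical
  refine val_embedding e (fun _ => ∅) g E g' E' (fun x => ?_) (fun x => ?_) hg (fun x => ?_) x
  · rw [Finset.union_empty]
    exact childBlocks_embedding e x (hp x) (hb x)
  · exact Finset.disjoint_empty_right _
  · simp [hE]

end PartitionedForest

/-! ### Values of products, graftings and raisings -/

namespace PartitionedTree

open ComPreLieRing Finset PartitionedForest

variable {D : Type u} {A : Type w} [ComPreLieRing A]

section

variable (T T' : PartitionedTree D)

/-- The vertices of `T` in `T · T'`. -/
def mulInl : T.V ↪ (T.mul T').V := ⟨Sum.inl, Sum.inl_injective⟩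

/-- The vertices of `T'` in `T · T'`. -/
def mulInr : T'.V ↪ (T.mul T').V := ⟨Sum.inr, Sum.inr_injective⟩

/-- The vertices of `T` in the grafting of `T'` on a vertex of `T`. -/
def graftInl (s : T.V) : T.V ↪ (T.graft s T').V := ⟨Sum.inl, Sum.inl_injective⟩

/-- The vertices of `T'` in the grafting of `T'` on a vertex of `T`. -/
def graftInr (s : T.V) : T'.V ↪ (T.graft s T').V := ⟨Sum.inr, Sum.inr_injective⟩

variable {T T'}

theorem mul_cases {P : (T.mul T').V → Prop} (inl : ∀ x, P (mulInl T T' x))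
    (inr : ∀ x, P (mulInr T T' x)) (x : (T.mul T').V) : P x := Sum.rec inl inr x

theorem graft_cases {s : T.V} {P : (T.graft s T').V → Prop} (inl : ∀ x, P (graftInl T T' s x))
    (inr : ∀ x, P (graftInr T T' s x)) (x : (T.graft s T').V) : P x := Sum.rec inl inr x

@[simp] theorem mulInl_ne_mulInr (x : T.V) (y : T'.V) : mulInl T T' x ≠ mulInr T T' y := nofun

@[simp] theorem mulInr_ne_mulInl (x : T.V) (y : T'.V) : mulInr T T' y ≠ mulInl T T' x := nofun

@[simp] theorem graftInl_ne_graftInr (s x : T.V) (y : T'.V) :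
    graftInl T T' s x ≠ graftInr T T' s y := nofun

@[simp] theorem graftInr_ne_graftInl (s x : T.V) (y : T'.V) :
    graftInr T T' s y ≠ graftInl T T' s x := nofun

@[simp] theorem parent_mulInl (x : T.V) :
    (T.mul T').parent (mulInl T T' x) = (T.parent x).map (mulInl T T') := rfl

@[simp] theorem parent_mulInr (x : T'.V) :
    (T.mul T').parent (mulInr T T' x) = (T'.parent x).map (mulInr T T') := rfl

@[simp] theorem parent_graftInl (s x : T.V) :
    (T.graft s T').parent (graftInl T T' s x) = (T.parent x).map (graftInl T T' s) := rfl

@[simp] theorem parent_graftInr (s : T.V) (x : T'.V) :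
    (T.graft s T').parent (graftInr T T' s x) =
      some ((T'.parent x).elim (graftInl T T' s s) (graftInr T T' s)) := rfl

/-- The block of a root would grow in `T · T'`; values involve only blocks of direct descendants, so
non-roots suffice. -/
theorem blockOf_mulInl {x y : T.V} (h : T.parent x = some y) :
    (T.mul T').blockOf (mulInl T T' x) = (T.blockOf x).map (mulInl T T') := by
  ext z
  rw [mem_blockOf]
  induction z using mul_cases with
  | inl z =>
    change T.block.r x z ↔ _
    rw [Finset.mem_map' (mulInl T T'), mem_blockOf]
  | inr z =>
    change T.parent x = none ∧ _ ↔ _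
    simp [h]

theorem blockOf_mulInr {x y : T'.V} (h : T'.parent x = some y) :
    (T.mul T').blockOf (mulInr T T' x) = (T'.blockOf x).map (mulInr T T') := by
  ext z
  rw [mem_blockOf]
  induction z using mul_cases with
  | inl z =>
    change T'.parent x = none ∧ _ ↔ _
    simp [h]
  | inr z =>
    change T'.block.r x z ↔ _
    rw [Finset.mem_map' (mulInr T T'), mem_blockOf]

theorem blockOf_graftInl (s x : T.V) :
    (T.graft s T').blockOf (graftInl T T' s x) = (T.blockOf x).map (graftInl T T' s) := by
  ext z
  rw [mem_blockOf]
  induction z using graft_cases with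
  | inl z =>
    change T.block.r x z ↔ _
    rw [Finset.mem_map' (graftInl T T' s), mem_blockOf]
  | inr z =>
    change False ↔ _
    simp

theorem blockOf_graftInr (s : T.V) (x : T'.V) :
    (T.graft s T').blockOf (graftInr T T' s x) = (T'.blockOf x).map (graftInr T T' s) := by
  ext z
  rw [mem_blockOf]
  induction z using graft_cases with
  | inl z =>
    change False ↔ _
    simp
  | inr z =>
    change T'.block.r x z ↔ _
    rw [Finset.mem_map' (graftInr T T' s), mem_blockOf]

theorem blockOf_eq_roots {x : T.V} (hx : T.parent x = none) : T.blockOf x = T.roots := by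
  ext y
  rw [mem_blockOf, mem_roots]
  exact ⟨fun h => (T.parent_eq_of_block _ _ h).symm.trans hx, T.block_of_roots x y hx⟩

variable (T T')

theorem disjoint_roots_mul :
    Disjoint (T.roots.map (mulInl T T')) (T'.roots.map (mulInr T T')) := by
  simp [Finset.disjoint_left]

theorem roots_mul : (T.mul T').roots =
    (T.roots.map (mulInl T T')).disjUnion (T'.roots.map (mulInr T T'))
      (disjoint_roots_mul T T') := by
  ext x
  rw [mem_roots]
  induction x using mul_cases with
  | inl x => simp [mem_roots]
  | inr x => simp [mem_roots]

theorem roots_graft (s : T.V) : (T.graft s T').roots = T.roots.map (graftInl T T' s) := by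
  ext x
  rw [mem_roots]
  induction x using graft_cases with
  | inl x => simp [mem_roots]
  | inr x => simp

theorem val_mulInl (g : (T.mul T').V → A) (E : (T.mul T').V → Multiset A) (x : T.V) :
    (T.mul T').val g E (mulInl T T' x) = T.val (g ∘ mulInl T T') (E ∘ mulInl T T') x := by
  refine val_embedding_of_parent (mulInl T T') _ _ g E (fun x y => ?_)
    (fun x y hy => blockOf_mulInl hy) (fun _ => rfl) (fun _ => rfl) x
  induction y using mul_cases with
  | inl y => simp
  | inr y => simp

theorem val_mulInr (g : (T.mul T').V → A) (E : (T.mul T').V → Multiset A) (x : T'.V) :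
    (T.mul T').val g E (mulInr T T' x) = T'.val (g ∘ mulInr T T') (E ∘ mulInr T T') x := by
  refine val_embedding_of_parent (mulInr T T') _ _ g E (fun x y => ?_)
    (fun x y hy => blockOf_mulInr hy) (fun _ => rfl) (fun _ => rfl) x
  induction y using mul_cases with
  | inl y => simp
  | inr y => simp

theorem val_graftInr (s : T.V) (g : (T.graft s T').V → A) (E : (T.graft s T').V → Multiset A)
    (x : T'.V) : (T.graft s T').val g E (graftInr T T' s x) =
      T'.val (g ∘ graftInr T T' s) (E ∘ graftInr T T' s) x := by
  refine val_embedding_of_parent (graftInr T T' s) _ _ g E (fun x y => ?_)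
    (fun _ y _ => blockOf_graftInr s y) (fun _ => rfl) (fun _ => rfl) x
  induction y using graft_cases with
  | inl y => simp
  | inr y => cases h : T'.parent y <;> simp [h]

theorem exists_mem_roots [Nonempty T.V] : ∃ r, r ∈ T.roots := by
  obtain ⟨r, hr, -⟩ := exists_root_isAncestor (Classical.arbitrary T.V)
  exact ⟨r, mem_roots.2 hr⟩

-- Grafting creates one new child block, that of the roots of `T'` below `s`; its product of values
-- is the new entry at `s`. An empty `T'` would create no block, so nonemptiness is essential.
open Classical in
theorem val_graftInl [Nonempty T'.V] (s : T.V) (g : (T.graft s T').V → A)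
    (E : (T.graft s T').V → Multiset A) (x : T.V) :
    (T.graft s T').val g E (graftInl T T' s x) =
      T.val (g ∘ graftInl T T' s) (Function.update (E ∘ graftInl T T' s) s
        ((∏ t ∈ T'.roots, T'.val (g ∘ graftInr T T' s) (E ∘ graftInr T T' s) t) ::ₘ
          E (graftInl T T' s s))) x := by
  obtain ⟨r, hr⟩ := exists_mem_roots T'
  refine val_embedding (graftInl T T' s)
    (fun x => if x = s then {T'.roots.map (graftInr T T' s)} else ∅) _ _ g E
    (fun x => ?_) (fun x => ?_) (fun _ => rfl) (fun x => ?_) x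
  · ext b
    simp only [Finset.mem_union, Finset.mem_image, mem_childBlocks]
    constructor
    · rintro ⟨y, hy, rfl⟩
      induction y using graft_cases with
      | inl y => exact Or.inl ⟨_, ⟨y, by simpa using hy, rfl⟩, (blockOf_graftInl s y).symm⟩
      | inr y =>
        cases hy' : T'.parent y with
        | some z => simp [hy'] at hy
        | none =>
          simp only [parent_graftInr, hy', Option.elim_none, Option.some.injEq,
            EmbeddingLike.apply_eq_iff_eq] at hy
          right
          rw [if_pos hy.symm, Finset.mem_singleton, blockOf_graftInr, blockOf_eq_roots hy']
    · rintro (⟨_, ⟨y, hy, rfl⟩, rfl⟩ | h)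
      · exact ⟨_, by simp [hy], blockOf_graftInl s y⟩
      · by_cases hx : x = s
        · subst hx
          rw [if_pos rfl, Finset.mem_singleton] at h
          refine ⟨graftInr T T' x r, by simp [mem_roots.1 hr], ?_⟩
          rw [h, blockOf_graftInr, blockOf_eq_roots (mem_roots.1 hr)]
        · simp [hx] at h
  · by_cases hx : x = s
    · rw [if_pos hx, Finset.disjoint_singleton_right, Finset.mem_image]
      rintro ⟨b, -, hb⟩
      have : graftInr T T' s r ∈ b.map (graftInl T T' s) := by
        rw [hb]
        exact Finset.mem_map_of_mem _ hr
      simp at this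
    · rw [if_neg hx]
      exact Finset.disjoint_empty_right _
  · by_cases hx : x = s
    · subst hx
      rw [Function.update_self, if_pos rfl, Finset.singleton_val, Multiset.map_singleton,
        ← Multiset.singleton_add, add_comm, Finset.prod_map]
      congr 2
      exact Finset.prod_congr rfl fun t _ => (val_graftInr T T' x g E t).symm
    · simp [hx]

end

/-- The value of a decorated partitioned tree: the product of the values of its roots. -/
noncomputable def eval (a : D → A) (T : PartitionedTree (ℕ × D)) : A :=
  ∏ x ∈ T.roots, T.val (fun x => a (T.dec x).2) (fun x => Multiset.replicate (T.dec x).1 1) x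

variable (a : D → A)

theorem eval_congr {T T' : PartitionedTree (ℕ × D)} (h : T ≈ T') : eval a T = eval a T' := by
  obtain ⟨e, hp, hb, hd⟩ := h
  have hr : T'.roots = T.roots.map e.toEmbedding := by
    ext y
    obtain ⟨x, rfl⟩ := e.surjective y
    rw [mem_roots, hp]
    simp [mem_roots]
  rw [eval, eval, hr, Finset.prod_map]
  refine Finset.prod_congr rfl fun x _ => (val_embedding_of_parent e.toEmbedding _ _ _ _ ?_ ?_
    (fun x => ?_) (fun x => ?_) x).symm
  · intro x y
    obtain ⟨y, rfl⟩ := e.surjective y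
    rw [hp]
    simp [e.injective.eq_iff]
  · intro x y _
    ext z
    obtain ⟨z, rfl⟩ := e.surjective z
    rw [mem_blockOf]
    change T'.block.r (e y) (e z) ↔ _
    rw [hb]
    simp [mem_blockOf]
  · simp [hd]
  · simp [hd]

theorem eval_mul (T T' : PartitionedTree (ℕ × D)) :
    eval a (T.mul T') = eval a T * eval a T' := by
  rw [eval, roots_mul]
  rw [Finset.prod_disjUnion, Finset.prod_map, Finset.prod_map]
  refine congrArg₂ _ ?_ ?_
  · exact Finset.prod_congr rfl fun x _ => val_mulInl T T' _ _ x
  · exact Finset.prod_congr rfl fun x _ => val_mulInr T T' _ _ x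

theorem eval_of_isEmpty (T : PartitionedTree (ℕ × D)) [IsEmpty T.V] : eval a T = 1 := by
  rw [eval, Finset.eq_empty_of_isEmpty T.roots, Finset.prod_empty]

theorem eval_vertex (d : D) : eval a (vertex (0, d)) = a d := by
  let r : (vertex (0, d)).V := ()
  have hr : (vertex (0, d)).roots = {r} := by
    ext x
    rw [mem_roots, Finset.mem_singleton]
    exact ⟨fun _ => rfl, fun _ => rfl⟩
  have hc : (vertex (0, d)).childBlocks r = ∅ := by
    ext b
    rw [mem_childBlocks]
    exact iff_of_false (by rintro ⟨y, hy, -⟩; cases hy) (Finset.notMem_empty b)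
  rw [eval, hr, Finset.prod_singleton, val_eq, hc]
  rfl

open Classical in
theorem eval_graft (T T' : PartitionedTree (ℕ × D)) [Nonempty T'.V] (s : T.V) :
    eval a (T.graft s T') = ∏ x ∈ T.roots, T.val (fun x => a (T.dec x).2)
      (Function.update (fun x => Multiset.replicate (T.dec x).1 1) s
        (eval a T' ::ₘ Multiset.replicate (T.dec s).1 1)) x := by
  rw [eval, roots_graft, Finset.prod_map]
  exact Finset.prod_congr rfl fun x _ => val_graftInl T T' s _ _ x

theorem raise_dec_of_eq {T : PartitionedTree (ℕ × D)} {s x : T.V} (h : x = s) :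
    (T.raise s).dec x = ((T.dec x).1 + 1, (T.dec x).2) := if_pos h

theorem raise_dec_of_ne {T : PartitionedTree (ℕ × D)} {s x : T.V} (h : x ≠ s) :
    (T.raise s).dec x = T.dec x := if_neg h

-- This has the same form as `eval_graft` with new entry `1`, the value of the empty tree, so both
-- cases of the product match `pre_eval`.
open Classical in
theorem eval_raise (T : PartitionedTree (ℕ × D)) (s : T.V) :
    eval a (T.raise s) = ∏ x ∈ T.roots, T.val (fun x => a (T.dec x).2)
      (Function.update (fun x => Multiset.replicate (T.dec x).1 1) s
        (1 ::ₘ Multiset.replicate (T.dec s).1 1)) x := by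
  have hg : (fun x : T.V => a ((T.raise s).dec x).2) = fun x => a (T.dec x).2 := by
    funext x
    by_cases hx : x = s
    · rw [raise_dec_of_eq hx]
    · rw [raise_dec_of_ne hx]
  have hE : (fun x : T.V => Multiset.replicate ((T.raise s).dec x).1 (1 : A)) =
      Function.update (fun x => Multiset.replicate (T.dec x).1 1) s
        (1 ::ₘ Multiset.replicate (T.dec s).1 1) := by
    funext x
    by_cases hx : x = s
    · rw [raise_dec_of_eq hx, hx, Function.update_self, Multiset.replicate_succ]
    · rw [raise_dec_of_ne hx, Function.update_of_ne hx]
  change ∏ x ∈ T.roots, T.val (fun x : T.V => a ((T.raise s).dec x).2)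
    (fun x : T.V => Multiset.replicate ((T.raise s).dec x).1 (1 : A)) x = _
  rw [hg, hE]

open Classical in
theorem pre_eval (T : PartitionedTree (ℕ × D)) (c : A) :
    pre (eval a T) c = ∑ s, ∏ x ∈ T.roots, T.val (fun x => a (T.dec x).2)
      (Function.update (fun x => Multiset.replicate (T.dec x).1 1) s
        (c ::ₘ Multiset.replicate (T.dec s).1 1)) x := by
  refine (sum_prod_roots_val_update _ _ c fun x e he => ?_).symm
  rw [Multiset.eq_of_mem_replicate he, one_pre]

end PartitionedTree

/-- The value of a class of decorated partitioned trees. -/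
noncomputable def UPT.eval {D : Type u} {A : Type w} [ComPreLieRing A] (a : D → A) : UPT D → A :=
  Quotient.lift (PartitionedTree.eval a) fun _ _ h => PartitionedTree.eval_congr a h

/-! ### Existence of the morphism -/

namespace UCP

open PartitionedTree

/-- The linear extension of the evaluation of trees. -/
noncomputable def lift (K : Type v) [Field K] {D : Type u} {A : Type w} [ComPreLieRing A]
    [Module K A] (a : D → A) : UCP K D →ₗ[K] A :=
  Finsupp.linearCombination K (UPT.eval a)

theorem lift_tree (K : Type v) [Field K] {D : Type u} {A : Type w} [ComPreLieRing A]
    [Module K A] (a : D → A) (T : PartitionedTree (ℕ × D)) :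
    lift K a (tree K T) = eval a T := by
  rw [lift, tree, Finsupp.linearCombination_single, one_smul]
  rfl

theorem exists_hom (K : Type v) [Field K] {D : Type u} {A : Type w} [AddCommGroup A] [Module K A]
    {mulA preA : A →ₗ[K] A →ₗ[K] A} {oneA : A} (h : IsUnitaryComPreLie mulA preA oneA)
    (a : D → A) : ∃ φ : UCP K D →ₗ[K] A,
      IsUnitaryComPreLieHom (mul K D) (pre K D) (one K D) mulA preA oneA φ ∧
      ∀ d, φ (tree K (vertex (0, d))) = a d := by
  -- The operations of this local structure unfold to `mulA`, `preA` and `oneA`, so the results on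
  -- Com-PreLie rings apply to `A` by definitional equality.
  let _ : ComPreLieRing A :=
    { ‹AddCommGroup A› with
      mul := fun x y => mulA x y
      one := oneA
      mul_assoc := h.mul_assoc
      mul_comm := h.mul_comm
      one_mul := h.one_mul
      mul_one := fun x => (h.mul_comm x oneA).trans (h.one_mul x)
      left_distrib := fun x y z => map_add (mulA x) y z
      right_distrib := fun x y z => by
        change mulA (x + y) z = mulA x z + mulA y z
        simp
      zero_mul := fun x => by
        change mulA 0 x = 0
        simp
      mul_zero := fun x => map_zero (mulA x)
      preHom := AddMonoidHom.mk' (fun x => (preA x).toAddMonoidHom) fun x y => by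
        ext z
        simp
      preHom_preHom := h.preLie
      mul_preHom := h.leibniz }
  refine ⟨lift K a, ⟨fun x y => ?_, fun x y => ?_, ?_⟩, fun d => ?_⟩
  · have : (mul K D).compr₂ (lift K a) = mulA.compl₁₂ (lift K a) (lift K a) := by
      refine hom_ext K fun T => hom_ext K fun T' => ?_
      rw [LinearMap.compr₂_apply, LinearMap.compl₁₂_apply, mul_tree, lift_tree, lift_tree,
        lift_tree, eval_mul]
      rfl
    exact congrArg (fun f => f x y) this
  · have : (pre K D).compr₂ (lift K a) = preA.compl₁₂ (lift K a) (lift K a) := by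
      refine hom_ext K fun T => hom_ext K fun T' => ?_
      rw [LinearMap.compr₂_apply, LinearMap.compl₁₂_apply, lift_tree, lift_tree]
      refine Eq.trans ?_ (pre_eval a T (eval a T')).symm
      rcases isEmpty_or_nonempty T'.V with h | h
      · rw [pre_tree_of_isEmpty, map_sum, eval_of_isEmpty a T']
        exact Finset.sum_congr rfl fun s _ => (lift_tree K a _).trans (eval_raise a T s)
      · rw [pre_tree_of_nonempty, map_sum]
        exact Finset.sum_congr rfl fun s _ => (lift_tree K a _).trans (eval_graft a T T' s)
    exact congrArg (fun f => f x y) this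
  · have : IsEmpty (empty (ℕ × D)).V := inferInstanceAs (IsEmpty Empty)
    exact (lift_tree K a _).trans (eval_of_isEmpty a _)
  · exact (lift_tree K a _).trans (eval_vertex a d)

end UCP

/-! ### Cutting trees into smaller trees -/

namespace PartitionedTree

open PartitionedForest Finset

variable {D : Type u}

section Restrict

open Classical in
/-- The parent map of the restriction of a forest to a set of vertices. -/
noncomputable def restrictParent (T : PartitionedTree D) (p : T.V → Prop) (x : {x // p x}) :
    Option {x // p x} :=
  (T.parent x).bind fun y => if h : p y then some ⟨y, h⟩ else none

variable {T : PartitionedTree D} {p : T.V → Prop}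

theorem restrictParent_eq_some {x y : {x // p x}} :
    T.restrictParent p x = some y ↔ T.parent x = some y.1 := by
  rw [restrictParent]
  cases h : T.parent x with
  | none => simp
  | some z =>
    by_cases hz : p z
    · simp [hz, Subtype.ext_iff]
    · simp only [Option.bind_some, hz, dite_false, reduceCtorEq, Option.some.injEq, false_iff]
      rintro rfl
      exact hz y.2

theorem restrictParent_eq_none {x : {x // p x}} :
    T.restrictParent p x = none ↔ ∀ y, T.parent x = some y → ¬ p y := by
  rw [Option.eq_none_iff_forall_ne_some]
  constructor
  · intro h y hy hp
    exact h ⟨y, hp⟩ (restrictParent_eq_some.2 hy)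
  · intro h y hy
    exact h y (restrictParent_eq_some.1 hy) y.2

variable (T p) in
open Classical in
/-- The restriction of a partitioned tree to a set of vertices, provided the resulting roots are
in one block. -/
noncomputable def restrict (h : ∀ x y : {x // p x}, T.restrictParent p x = none →
    T.restrictParent p y = none → T.block.r x y) : PartitionedTree D where
  V := {x // p x}
  parent := T.restrictParent p
  wf := Subrelation.wf (fun h => restrictParent_eq_some.1 h) (InvImage.wf Subtype.val T.wf)
  block := T.block.comap Subtype.val
  parent_eq_of_block x y h := by
    simp only [restrictParent]
    rw [T.parent_eq_of_block _ _ h]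
  dec x := T.dec x
  block_of_roots := h

-- If no edge crosses between `p` and its complement, the only block meeting both is the block of
-- roots, which is what the product joins.
open Classical in
theorem exists_mul_equiv (hp : ∀ x y, T.parent x = some y → (p x ↔ p y)) :
    ∃ (h : _) (h' : _), (T.restrict p h).mul (T.restrict (fun x => ¬ p x) h') ≈ T := by
  have hn : ∀ x : {x // p x}, T.restrictParent p x = none ↔ T.parent x = none := by
    intro x
    rw [restrictParent_eq_none, Option.eq_none_iff_forall_ne_some]
    exact forall_congr' fun y => ⟨fun h e => h e ((hp _ _ e).1 x.2), fun h e => (h e).elim⟩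
  have hn' : ∀ x : {x // ¬ p x}, T.restrictParent (fun x => ¬ p x) x = none ↔
      T.parent x = none := by
    intro x
    rw [restrictParent_eq_none, Option.eq_none_iff_forall_ne_some]
    exact forall_congr' fun y => ⟨fun h e => h e fun h' => x.2 ((hp _ _ e).2 h'),
      fun h e => (h e).elim⟩
  refine ⟨fun x y hx hy => T.block_of_roots _ _ ((hn x).1 hx) ((hn y).1 hy),
    fun x y hx hy => T.block_of_roots _ _ ((hn' x).1 hx) ((hn' y).1 hy),
    ⟨⟨Equiv.sumCompl p, ?_, ?_, ?_⟩⟩⟩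
  · rintro (x | x)
    · change T.parent x.1 = ((T.restrictParent p x).map Sum.inl).map _
      cases h : T.restrictParent p x with
      | none => exact (hn x).1 h
      | some y => exact restrictParent_eq_some.1 h
    · change T.parent x.1 = ((T.restrictParent _ x).map Sum.inr).map _
      cases h : T.restrictParent _ x with
      | none => exact (hn' x).1 h
      | some y => exact restrictParent_eq_some.1 h
  · have hb : ∀ x y, p x → ¬ p y → (T.block.r x y ↔ T.parent x = none ∧ T.parent y = none) := by
      refine fun x y hx hy => ⟨fun h => ?_, fun h => T.block_of_roots _ _ h.1 h.2⟩
      have e := T.parent_eq_of_block _ _ h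
      rw [← e, and_self]
      cases h' : T.parent x with
      | none => rfl
      | some z => exact absurd ((hp y z (e.symm.trans h')).2 ((hp x z h').1 hx)) hy
    rintro (x | x) (y | y)
    · exact Iff.rfl
    · exact (hb x.1 y.1 x.2 y.2).trans (and_congr (hn x).symm (hn' y).symm)
    · refine Iff.trans ⟨T.block.iseqv.symm, T.block.iseqv.symm⟩ ((hb y.1 x.1 y.2 x.2).trans ?_)
      exact and_comm.trans (and_congr (hn' x).symm (hn y).symm)
    · exact Iff.rfl
  · rintro (x | x) <;> rfl

open Classical in
/-- The block of `x` can be cut off, together with all its iterated descendants. -/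
theorem exists_graft_equiv {x s : T.V} (hx : T.parent x = some s) :
    ∃ (T' S : PartitionedTree D) (r : T'.V), Nonempty S.V ∧
      ((∀ y, T.parent y = none ↔ y = s) → ∀ y, T'.parent y = none ↔ y = r) ∧
        T'.graft r S ≈ T := by
  -- The part cut off: it is closed under descendants and blocks, it avoids `s`, and its roots form
  -- exactly the block of `x`, as grafting requires.
  let q : T.V → Prop := fun y => ∃ t, T.block.r x t ∧ T.IsAncestor t y
  have hqx : ∀ t, T.block.r x t → q t := fun t ht => ⟨t, ht, .refl t⟩
  have hup : ∀ y z, T.parent y = some z → q z → q y := by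
    rintro y z hy ⟨t, ht, h⟩
    exact ⟨t, ht, h.tail hy⟩
  have hq : ∀ y, q y → T.block.r x y ∨ ∃ z, q z ∧ T.parent y = some z := by
    rintro y ⟨t, ht, h⟩
    obtain rfl | ⟨z, hz, hy⟩ := h.eq_or
    · exact Or.inl ht
    · exact Or.inr ⟨z, ⟨t, ht, hz⟩, hy⟩
  have hbs : ∀ t, T.block.r x t → T.parent t = some s := fun t ht =>
    (T.parent_eq_of_block _ _ ht).symm.trans hx
  have hs : ¬ q s := by
    rintro ⟨t, ht, h⟩
    exact not_isAncestor_of_parent (hbs t ht) h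
  have hn : ∀ y : {y // ¬ q y}, T.restrictParent (fun y => ¬ q y) y = none ↔
      T.parent y = none := by
    intro y
    rw [restrictParent_eq_none, Option.eq_none_iff_forall_ne_some]
    exact forall_congr' fun z => ⟨fun h e => h e fun h' => y.2 (hup _ _ e h'),
      fun h e => (h e).elim⟩
  have hn' : ∀ y : {y // q y}, T.restrictParent q y = none → T.block.r x y := by
    intro y h
    rw [restrictParent_eq_none] at h
    obtain hy | ⟨z, hz, hy⟩ := hq y y.2
    · exact hy
    · exact absurd hz (h z hy)
  have hblock : ∀ y z, q y → T.block.r y z → q z := by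
    intro y z hy h
    obtain hy | ⟨t, ht, hy⟩ := hq y hy
    · exact hqx z (T.block.iseqv.trans hy h)
    · exact hup z t ((T.parent_eq_of_block _ _ h).symm.trans hy) ht
  let T' := T.restrict (fun y => ¬ q y)
    fun y z hy hz => T.block_of_roots _ _ ((hn y).1 hy) ((hn z).1 hz)
  let S := T.restrict q fun y z hy hz => T.block.iseqv.trans (T.block.iseqv.symm (hn' y hy))
    (hn' z hz)
  refine ⟨T', S, ⟨s, hs⟩, ⟨⟨x, hqx x (T.block.iseqv.refl x)⟩⟩, ?_,
    ⟨⟨(Equiv.sumComm _ _).trans (Equiv.sumCompl q), ?_, ?_, ?_⟩⟩⟩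
  · intro h y
    exact (hn y).trans ((h y.1).trans (Subtype.ext_iff (a1 := y) (a2 := ⟨s, hs⟩)).symm)
  · rintro (y | y)
    · change T.parent y.1 = ((T.restrictParent _ y).map Sum.inl).map _
      cases h : T.restrictParent _ y with
      | none => exact (hn y).1 h
      | some z => exact restrictParent_eq_some.1 h
    · change T.parent y.1 = (some ((T.restrictParent q y).elim
        (Sum.inl (⟨s, hs⟩ : {y // ¬ q y})) Sum.inr)).map _
      cases h : T.restrictParent q y with
      | none => exact hbs _ (hn' y h)
      | some z => exact restrictParent_eq_some.1 h
  · rintro (y | y) (z | z)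
    · exact Iff.rfl
    · exact iff_of_false (fun h => y.2 (hblock _ _ z.2 (T.block.iseqv.symm h))) id
    · exact iff_of_false (fun h => z.2 (hblock _ _ y.2 h)) id
    · exact Iff.rfl
  · rintro (y | y) <;> rfl

end Restrict

open Classical in
/-- The integer decoration of a vertex is lowered by one. -/
noncomputable def lower (T : PartitionedTree (ℕ × D)) (r : T.V) : PartitionedTree (ℕ × D) :=
  { T with dec := fun x => if x = r then ((T.dec x).1 - 1, (T.dec x).2) else T.dec x }

theorem raise_lower_equiv {T : PartitionedTree (ℕ × D)} {r : T.V} (hr : (T.dec r).1 ≠ 0) :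
    (T.lower r).raise r ≈ T := by
  refine ⟨⟨Equiv.refl T.V, fun x => (congrFun Option.map_id _).symm, fun _ _ => Iff.rfl,
    fun (x : T.V) => ?_⟩⟩
  change T.dec x = ((T.lower r).raise r).dec x
  by_cases hx : x = r
  · have h : (T.lower r).dec x = ((T.dec x).1 - 1, (T.dec x).2) := if_pos hx
    rw [raise_dec_of_eq (T := T.lower r) hx, h]
    subst hx
    ext
    · exact (Nat.sub_add_cancel (Nat.pos_of_ne_zero hr)).symm
    · rfl
  · rw [raise_dec_of_ne (T := T.lower r) hx]
    exact (if_neg hx).symm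

theorem equiv_vertex {T : PartitionedTree D} {r : T.V} (h : ∀ x, x = r) :
    vertex (T.dec r) ≈ T := by
  have hr : T.parent r = none := by
    obtain ⟨s, hs, -⟩ := exists_root_isAncestor r
    rwa [h s] at hs
  refine ⟨⟨⟨fun _ => r, fun _ => (), fun _ => rfl, fun x => (h x).symm⟩, fun x => hr,
    fun x y => ⟨fun _ => trivial, fun _ => T.block.iseqv.refl r⟩, fun _ => rfl⟩⟩

/-- A decorated partitioned tree is empty, a vertex, a product, or obtained from a tree with one
root by a modification at this root. -/
theorem decomposition (T : PartitionedTree (ℕ × D)) :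
    IsEmpty T.V ∨ (∃ d, vertex (0, d) ≈ T) ∨
    (∃ T₁ T₂ : PartitionedTree (ℕ × D), Nonempty T₁.V ∧ Nonempty T₂.V ∧ T₁.mul T₂ ≈ T) ∨
    (∃ (T' : PartitionedTree (ℕ × D)) (r : T'.V), (∀ x, T'.parent x = none ↔ x = r) ∧
      T'.raise r ≈ T) ∨
    ∃ (T' S : PartitionedTree (ℕ × D)) (r : T'.V), Nonempty S.V ∧
      (∀ x, T'.parent x = none ↔ x = r) ∧ T'.graft r S ≈ T := by
  rcases isEmpty_or_nonempty T.V with h | h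
  · exact Or.inl h
  right
  obtain ⟨r, hr⟩ := exists_mem_roots T
  rw [mem_roots] at hr
  by_cases hu : ∃ r', T.parent r' = none ∧ r' ≠ r
  · obtain ⟨r', hr', hne⟩ := hu
    -- With a second root `r'`, the branch of `r` and the rest are both nonempty factors.
    obtain ⟨h₁, h₂, e⟩ := exists_mul_equiv (p := T.IsAncestor r) fun x y hxy =>
      ⟨fun h => h.of_parent (by rintro rfl; simp [hr] at hxy) hxy, fun h => h.tail hxy⟩
    exact Or.inr (Or.inl ⟨_, _, ⟨(⟨r, .refl r⟩ : {x // T.IsAncestor r x})⟩,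
      ⟨(⟨r', fun h => hne (h.eq_of_root hr').symm⟩ : {x // ¬ T.IsAncestor r x})⟩, e⟩)
  have hu : ∀ y, T.parent y = none ↔ y = r := fun y =>
    ⟨fun hy => by_contra fun h => hu ⟨y, hy, h⟩, fun hy => hy ▸ hr⟩
  by_cases hd : (T.dec r).1 = 0
  · by_cases hc : ∃ x, T.parent x = some r
    · obtain ⟨x, hx⟩ := hc
      obtain ⟨T', S, r', hS, hr', e⟩ := exists_graft_equiv hx
      exact Or.inr (Or.inr (Or.inr ⟨T', S, r', hS, hr' hu, e⟩))
    · left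
      refine ⟨(T.dec r).2, ?_⟩
      have := equiv_vertex (T := T) (r := r) fun x => ?_
      · rwa [← hd]
      -- A vertex other than `r` would have an ascendant, equal to `r` by induction, whereas `r` has
      -- no direct descendant.
      · induction x using T.wf.induction with
        | _ x ih =>
          rw [← hu]
          cases hx : T.parent x with
          | none => rfl
          | some y => exact absurd ⟨x, ih y hx ▸ hx⟩ hc
  · exact Or.inr (Or.inr (Or.inl ⟨T.lower r, r, hu, raise_lower_equiv hd⟩))

/-! ### The induction measure: weight and root fertility -/

/-- The number of vertices plus the sum of the integer decorations. -/
def weight (T : PartitionedTree (ℕ × D)) : ℕ := ∑ x, ((T.dec x).1 + 1)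

/-- The contribution of a vertex to the fertility of the roots. -/
def rootFertilityAt (T : PartitionedTree (ℕ × D)) (x : T.V) : ℕ :=
  (T.parent x).elim (T.dec x).1 fun y => (T.parent y).elim 1 fun _ => 0

/-- The sum of the integer decorations of the roots, plus the number of their direct
descendants. -/
def rootFertility (T : PartitionedTree (ℕ × D)) : ℕ := ∑ x, T.rootFertilityAt x

theorem weight_congr {T T' : PartitionedTree (ℕ × D)} (h : T ≈ T') : T.weight = T'.weight := by
  obtain ⟨e, hp, hb, hd⟩ := h
  exact Fintype.sum_equiv e _ _ fun x => by rw [hd]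

theorem rootFertility_congr {T T' : PartitionedTree (ℕ × D)} (h : T ≈ T') :
    T.rootFertility = T'.rootFertility := by
  obtain ⟨e, hp, hb, hd⟩ := h
  refine Fintype.sum_equiv e _ _ fun x => ?_
  rw [rootFertilityAt, rootFertilityAt, hp, hd]
  cases T.parent x with
  | none => rfl
  | some y =>
    simp only [Option.map_some, Option.elim_some, hp]
    cases T.parent y <;> rfl

theorem weight_pos (T : PartitionedTree (ℕ × D)) [Nonempty T.V] : 0 < T.weight :=
  Finset.sum_pos (fun _ _ => Nat.succ_pos _) Finset.univ_nonempty

theorem weight_mul (T T' : PartitionedTree (ℕ × D)) :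
    (T.mul T').weight = T.weight + T'.weight := Fintype.sum_sum_type _

theorem weight_graft (T T' : PartitionedTree (ℕ × D)) (s : T.V) :
    (T.graft s T').weight = T.weight + T'.weight := Fintype.sum_sum_type _

theorem weight_raise (T : PartitionedTree (ℕ × D)) (s : T.V) :
    (T.raise s).weight = T.weight + 1 := by
  classical
  have h : ∀ x : T.V, ((T.raise s).dec x).1 + 1 = (T.dec x).1 + 1 + if x = s then 1 else 0 := by
    intro x
    by_cases hx : x = s
    · rw [raise_dec_of_eq hx, if_pos hx]
    · rw [raise_dec_of_ne hx, if_neg hx]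
  change ∑ x : T.V, (((T.raise s).dec x).1 + 1) = _
  simp only [h]
  rw [Finset.sum_add_distrib]
  simp [weight]

/-- Together with its three analogues below, this singles out the term modified at the root: in a
one-root tree, only that modification increases root fertility. -/
theorem rootFertility_raise_of_root (T : PartitionedTree (ℕ × D)) {s : T.V}
    (hs : T.parent s = none) : T.rootFertility < (T.raise s).rootFertility := by
  refine Finset.sum_lt_sum (s := (Finset.univ : Finset T.V)) (fun x _ => ?_)
    ⟨s, Finset.mem_univ s, ?_⟩
  · change (T.parent x).elim (T.dec x).1 _ ≤ (T.parent x).elim ((T.raise s).dec x).1 _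
    cases T.parent x with
    | some y => exact le_rfl
    | none =>
      by_cases hx : x = s
      · rw [raise_dec_of_eq hx]
        exact Nat.le_succ _
      · rw [raise_dec_of_ne hx]
        exact le_rfl
  · change (T.parent s).elim (T.dec s).1 _ < (T.parent s).elim ((T.raise s).dec s).1 _
    rw [hs, raise_dec_of_eq rfl]
    exact Nat.lt_succ_self _

theorem rootFertility_raise_of_not_root (T : PartitionedTree (ℕ × D)) {s : T.V}
    (hs : T.parent s ≠ none) : (T.raise s).rootFertility = T.rootFertility := by
  refine Finset.sum_congr (s₁ := (Finset.univ : Finset T.V)) rfl fun x _ => ?_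
  change (T.parent x).elim ((T.raise s).dec x).1 _ = (T.parent x).elim (T.dec x).1 _
  cases hx : T.parent x with
  | some y => rfl
  | none => rw [raise_dec_of_ne (fun h => hs (by rw [← h, hx]))]; rfl

theorem rootFertility_graft (T S : PartitionedTree (ℕ × D)) (s : T.V) :
    (T.graft s S).rootFertility = T.rootFertility +
      ∑ y : S.V, (S.parent y).elim ((T.parent s).elim 1 fun _ => 0) fun _ => 0 := by
  refine (Fintype.sum_sum_type _).trans (congrArg₂ _ ?_ ?_)
  · refine Finset.sum_congr rfl fun x _ => ?_
    change ((T.parent x).map (graftInl T S s)).elim (T.dec x).1 _ =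
      (T.parent x).elim (T.dec x).1 _
    cases T.parent x with
    | none => rfl
    | some y =>
      change ((T.parent y).map (graftInl T S s)).elim 1 _ = (T.parent y).elim 1 _
      cases T.parent y <;> rfl
  · refine Finset.sum_congr rfl fun y _ => ?_
    change ((T.graft s S).parent ((S.parent y).elim (graftInl T S s s) (graftInr T S s))).elim
      1 _ = _
    cases S.parent y with
    | some z => rfl
    | none =>
      change ((T.parent s).map (graftInl T S s)).elim 1 _ = (T.parent s).elim 1 _
      cases T.parent s <;> rfl

theorem rootFertility_graft_of_root (T S : PartitionedTree (ℕ × D)) [Nonempty S.V] {s : T.V}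
    (hs : T.parent s = none) : T.rootFertility < (T.graft s S).rootFertility := by
  obtain ⟨r, hr⟩ := exists_mem_roots S
  rw [rootFertility_graft, lt_add_iff_pos_right]
  refine Finset.sum_pos' (fun _ _ => Nat.zero_le _) ⟨r, Finset.mem_univ r, ?_⟩
  simp [mem_roots.1 hr, hs]

theorem rootFertility_graft_of_not_root (T S : PartitionedTree (ℕ × D)) {s : T.V}
    (hs : T.parent s ≠ none) : (T.graft s S).rootFertility = T.rootFertility := by
  obtain ⟨x, hx⟩ := Option.ne_none_iff_exists'.1 hs
  rw [rootFertility_graft, Finset.sum_eq_zero fun y _ => ?_, add_zero]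
  rw [hx]
  cases S.parent y <;> rfl

/-- Induction on decorated partitioned trees: a raising or a grafting at a vertex `r` can be
deduced from those at the other vertices. -/
theorem induction_on {P : PartitionedTree (ℕ × D) → Prop} (T : PartitionedTree (ℕ × D))
    (congr : ∀ T T', T ≈ T' → P T → P T') (empty : P (empty _))
    (vertex : ∀ d, P (vertex (0, d))) (mul : ∀ T T', P T → P T' → P (T.mul T'))
    (raise : ∀ (T : PartitionedTree (ℕ × D)) (r : T.V), P T → (∀ s ≠ r, P (T.raise s)) →
      P (T.raise r))
    (graft : ∀ (T S : PartitionedTree (ℕ × D)) (r : T.V), Nonempty S.V → P T → P S →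
      (∀ s ≠ r, P (T.graft s S)) → P (T.graft r S)) : P T := by
  -- The induction is lexicographic: on the weight `n`, then on the root fertility `k`.
  suffices ∀ n k T, T.weight = n → T.rootFertility = k → P T from this _ _ T rfl rfl
  intro n
  induction n using Nat.strong_induction_on with
  | _ n ihn =>
    intro k
    induction k using Nat.strong_induction_on with
    | _ k ihk =>
      intro T hn hk
      obtain h | ⟨d, e⟩ | ⟨T₁, T₂, h₁, h₂, e⟩ | ⟨T', r, hr, e⟩ | ⟨T', S, r, hS, hr, e⟩ :=
        decomposition T
      · exact congr _ _ (Setoid.symm (equiv_empty T)) empty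
      · exact congr _ _ e (vertex d)
      · have hw := (weight_mul T₁ T₂).symm.trans ((weight_congr e).trans hn)
        have := T₁.weight_pos
        have := T₂.weight_pos
        exact congr _ _ e (mul _ _ (ihn _ (by omega) _ _ rfl rfl) (ihn _ (by omega) _ _ rfl rfl))
      · have hw := (weight_raise T' r).symm.trans ((weight_congr e).trans hn)
        have hf := (rootFertility_raise_of_root T' ((hr r).2 rfl)).trans_eq
          ((rootFertility_congr e).trans hk)
        refine congr _ _ e (raise _ _ (ihn _ (by omega) _ _ rfl rfl) fun s hs => ?_)
        -- A raising at `s ≠ r` keeps the weight `n` and has the root fertility of `T'`, which is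
        -- below `k`.
        refine ihk _ ?_ _ ((weight_raise T' s).trans hw) rfl
        rwa [rootFertility_raise_of_not_root T' fun h => hs ((hr s).1 h)]
      · have hw := (weight_graft T' S r).symm.trans ((weight_congr e).trans hn)
        have hf := (rootFertility_graft_of_root T' S ((hr r).2 rfl)).trans_eq
          ((rootFertility_congr e).trans hk)
        have : Nonempty T'.V := ⟨r⟩
        have := S.weight_pos
        have := T'.weight_pos
        refine congr _ _ e (graft _ _ _ hS (ihn _ (by omega) _ _ rfl rfl)
          (ihn _ (by omega) _ _ rfl rfl) fun s hs => ?_)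
        refine ihk _ ?_ _ ((weight_graft T' S s).trans hw) rfl
        rwa [rootFertility_graft_of_not_root T' S fun h => hs ((hr s).1 h)]

end PartitionedTree

/-! ### Uniqueness of the morphism -/

namespace UCP

open PartitionedTree

theorem hom_unique (K : Type v) [Field K] {D : Type u} {A : Type w} [AddCommGroup A] [Module K A]
    {mulA preA : A →ₗ[K] A →ₗ[K] A} {oneA : A} {φ ψ : UCP K D →ₗ[K] A}
    (hφ : IsUnitaryComPreLieHom (mul K D) (pre K D) (one K D) mulA preA oneA φ)
    (hψ : IsUnitaryComPreLieHom (mul K D) (pre K D) (one K D) mulA preA oneA ψ)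
    (h : ∀ d, φ (tree K (vertex (0, d))) = ψ (tree K (vertex (0, d)))) : φ = ψ := by
  refine hom_ext K fun T => ?_
  induction T using PartitionedTree.induction_on with
  | congr T T' e ih => rwa [← tree_eq_of_equiv K e]
  | empty => exact hφ.map_one.trans hψ.map_one.symm
  | vertex d => exact h d
  | mul T T' ih ih' => rw [← mul_tree, hφ.map_mul, hψ.map_mul, ih, ih']
  | raise T r ih ihs =>
    classical
    have e : φ (pre K D (tree K T) (one K D)) = ψ (pre K D (tree K T) (one K D)) := by
      rw [hφ.map_pre, hψ.map_pre, hφ.map_one, hψ.map_one, ih]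
    have : IsEmpty (empty (ℕ × D)).V := inferInstanceAs (IsEmpty Empty)
    rw [one, pre_tree_of_isEmpty, map_sum, map_sum,
      ← Finset.add_sum_erase _ _ (Finset.mem_univ r),
      ← Finset.add_sum_erase _ _ (Finset.mem_univ r),
      Finset.sum_congr rfl fun s hs => ihs s (Finset.ne_of_mem_erase hs)] at e
    -- Both morphisms agree on the whole sum and, by `ihs`, on every term with `s ≠ r`, hence on the
    -- term at `r`.
    exact add_right_cancel e
  | graft T S r hS ih ih' ihs =>
    classical
    have e : φ (pre K D (tree K T) (tree K S)) = ψ (pre K D (tree K T) (tree K S)) := by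
      rw [hφ.map_pre, hψ.map_pre, ih, ih']
    rw [pre_tree_of_nonempty, map_sum, map_sum,
      ← Finset.add_sum_erase _ _ (Finset.mem_univ r),
      ← Finset.add_sum_erase _ _ (Finset.mem_univ r),
      Finset.sum_congr rfl fun s hs => ihs s (Finset.ne_of_mem_erase hs)] at e
    exact add_right_cancel e

end UCP

theorem mainTheorem5 (K : Type v) [Field K] [CharZero K] (D : Type u) :
    IsUnitaryComPreLie (UCP.mul K D) (UCP.pre K D) (UCP.one K D) ∧
    ∀ (A : Type w) [AddCommGroup A] [Module K A] (mulA preA : A →ₗ[K] A →ₗ[K] A) (oneA : A),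
      IsUnitaryComPreLie mulA preA oneA →
      ∀ a : D → A, ∃! φ : UCP K D →ₗ[K] A,
        IsUnitaryComPreLieHom (UCP.mul K D) (UCP.pre K D) (UCP.one K D) mulA preA oneA φ ∧
        ∀ d : D, φ (UCP.tree K (PartitionedTree.vertex (0, d))) = a d := by
  refine ⟨UCP.isUnitaryComPreLie K D, fun A _ _ mulA preA oneA h a => ?_⟩
  obtain ⟨φ, hφ, hφa⟩ := UCP.exists_hom K h a
  exact ⟨φ, ⟨hφ, hφa⟩, fun ψ ⟨hψ, hψa⟩ => UCP.hom_unique K hψ hφ fun d =>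
    (hψa d).trans (hφa d).symm⟩
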